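/- Let $d\ge 0$ be an integer and $\kappa>0$. For $D>d$ and $M\subset\mathbb{R}^D$ write $M\oplus r$ for the union of the open balls of radius $r$ centred at points of $M$, and let the reach $\Delta(M)$ be the largest $r$ such that each point of $M\oplus r$ has a unique nearest point in $M$. For a compact set $K\subset\mathbb{R}^D$ let $\mathcal{M}=\mathcal{M}_{d,D,K}(\kappa)$ be the set of all nonempty compact smooth $d$-dimensional embedded submanifolds $M$ of $\mathbb{R}^D$ without boundary such that $M\subset K$ and $\Delta(M)\ge\kappa$. For $0<\sigma<\kappa$ and $M\in\mathcal{M}$ let $Q_M$ be the distribution of the random point $Y\in\mathbb{R}^D$ obtained as follows: draw $\xi$ from the uniform distribution on $M$ (normalized $d$-dimensional volume); given $\xi$, draw $Y$ uniformly (normalized $(D-d)$-dimensional volume) from the fiber $L_\sigma(\xi)=\{y\in\mathbb{R}^D:\ y-\xi\perp T_\xi M,\ \|y-\xi\|<\sigma\}$. Let $S_M=M\oplus\sigma$ and let $u_M=1/V(S_M)$ be the density of the uniform distribution on $S_M$, where $V$ is Lebesgue measure on $\mathbb{R}^D$. There is a constant $C_*>0$ depending only on $\kappa$ and $d$ and,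 for each $\sigma$ with $0<\sigma<\kappa$, a constant $C^*$ with $C_*\le C^*<\infty$ depending only on $\kappa$, $d$ and $\sigma$, such that for every $D>d$ and every compact $K\subset\mathbb{R}^D$ for which $\mathcal{M}$ is nonempty, each $Q_M$ with $M\in\mathcal{M}$ has a density $q_M$ with respect to Lebesgue measure, and $$C_*\ \le\ \inf_{M\in\mathcal{M}}\ \operatorname*{ess\,inf}_{y\in S_M}\frac{q_M(y)}{u_M(y)}\ \le\ \sup_{M\in\mathcal{M}}\ \operatorname*{ess\,sup}_{y\in S_M}\frac{q_M(y)}{u_M(y)}\ \le\ C^*.$$ -/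

import Mathlib

open MeasureTheory Set
open scoped ENNReal NNReal ContDiff

noncomputable section

namespace TubeModel

variable {D : ℕ}

/-- `M ⊆ ℝ^D` is an embedded smooth (`C^∞`) `d`-dimensional submanifold without boundary: around
each of its points there is a diffeomorphism between open subsets of `ℝ^D` that straightens `M` to
the coordinate subspace `ℝ^d × {0}`. -/
def IsSubmanifold (d : ℕ) (M : Set (EuclideanSpace ℝ (Fin D))) : Prop :=
  ∀ p ∈ M, ∃ Φ : OpenPartialHomeomorph (EuclideanSpace ℝ (Fin D)) (EuclideanSpace ℝ (Fin D)),
    p ∈ Φ.source ∧ ContDiffOn ℝ ∞ Φ Φ.source ∧ ContDiffOn ℝ ∞ Φ.symm Φ.target ∧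
      ∀ x ∈ Φ.source, x ∈ M ↔ ∀ i : Fin D, d ≤ (i : ℕ) → Φ x i = 0

/-- The reach (condition number) `Δ(M)`: the largest `r` such that each point of `M ⊕ r`
(the union of the open balls of radius `r` centred on `M`) has a unique nearest point in `M`. -/
def reach (M : Set (EuclideanSpace ℝ (Fin D))) : ℝ≥0∞ :=
  ⨆ (r : ℝ≥0) (_ : ∀ x ∈ Metric.thickening (r : ℝ) M, ∃! y, y ∈ M ∧ dist x y = Metric.infDist x M),
    (r : ℝ≥0∞)

/-- The class `𝓜(κ)`: compact `d`-dimensional submanifolds of `ℝ^D` without boundary which are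
contained in `K` and have reach at least `κ`. -/
def manifoldClass (d : ℕ) (κ : ℝ) (K : Set (EuclideanSpace ℝ (Fin D))) :
    Set (Set (EuclideanSpace ℝ (Fin D))) :=
  {M | M.Nonempty ∧ IsCompact M ∧ IsSubmanifold d M ∧ M ⊆ K ∧ ENNReal.ofReal κ ≤ reach M}

/-- The tangent space of `M` at `u` as a linear subspace (the tangent cone of a submanifold is
already linear). -/
def tangentSpace (M : Set (EuclideanSpace ℝ (Fin D))) (u : EuclideanSpace ℝ (Fin D)) :
    Submodule ℝ (EuclideanSpace ℝ (Fin D)) :=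
  Submodule.span ℝ (tangentConeAt ℝ M u)

/-- The fiber `L_σ(u)`: the points of the affine normal space of `M` at `u` which are at distance
less than `σ` from `u`. -/
def fiber (σ : ℝ) (M : Set (EuclideanSpace ℝ (Fin D))) (u : EuclideanSpace ℝ (Fin D)) :
    Set (EuclideanSpace ℝ (Fin D)) :=
  {y | y - u ∈ (tangentSpace M u)ᗮ} ∩ Metric.ball u σ

/-- The uniform probability measure on a set `A` of dimension `k`: normalized `k`-dimensional
Hausdorff measure on `A`. -/
def uniformOn (k : ℝ) (A : Set (EuclideanSpace ℝ (Fin D))) :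
    Measure (EuclideanSpace ℝ (Fin D)) :=
  ProbabilityTheory.cond (Measure.hausdorffMeasure k) A

/-- The law `Q_M` of `Y = ξ + Z`, where `ξ` is uniform on `M` and, given `ξ`, the point `Y` is
uniform on the fiber `L_σ(ξ)`; that is, `Q_M(A) = ∫_M Γ_u(A) dΛ_M(u)`. -/
def noisyLaw (d : ℕ) (σ : ℝ) (M : Set (EuclideanSpace ℝ (Fin D))) :
    Measure (EuclideanSpace ℝ (Fin D)) :=
  (uniformOn (d : ℝ) M).bind fun u => uniformOn ((D : ℝ) - d) (fiber σ M u)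

/-- The density `q_M` of `Q_M` with respect to Lebesgue measure. -/
def noisyDensity (d : ℕ) (σ : ℝ) (M : Set (EuclideanSpace ℝ (Fin D))) :
    EuclideanSpace ℝ (Fin D) → ℝ≥0∞ :=
  (noisyLaw d σ M).rnDeriv volume

/-- The density `u_M` of the uniform distribution on `M ⊕ σ`. -/
def uniformDensity (σ : ℝ) (M : Set (EuclideanSpace ℝ (Fin D))) :
    EuclideanSpace ℝ (Fin D) → ℝ≥0∞ :=
  (Metric.thickening σ M).indicator fun _ => 1 / volume (Metric.thickening σ M)

end TubeModel

end

/-! The tube around `M` is fibred by normal discs. The tube map `(u, z) ↦ u + z` has Jacobian `J =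
|det (I + S_z)|`, where `S_z` is minus the shape operator in the normal direction `z`. So `q_M` is a
constant divided by `J`, and `q_M / u_M` at a point is the average of `J` over the normal disc
bundle divided by the value of `J` there. The theorem amounts to three bounds: `J` from above, `J`
from below, and the average of `J` from below by a constant not involving `D` or `σ`.

The reach enters through `isTubular_of_le_reach`: a normal segment shorter than `κ` is minimizing.
Very short ones are so by Taylor expansion (`exists_infDist_normal`); `infDist_extend` prolongs
them, by maximizing the distance to `M` on a ball. Hence the tube map is injective onto the tube.
Comparing minimizing normals at two nearby feet gives `‖S_z‖ ≤ ‖z‖ / κ`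
(`NormalChart.abs_inner_fderiv_n_le`), so `J` lies between `(1 - ‖z‖ / κ) ^ d` and `2 ^ d`.

That pointwise lower bound degenerates as `σ` tends to `κ`, so it serves for the upper constant
only. For the average, the entries of `S_z` are `d * d` linear forms in `z`, bounded by one on the
disc. In high codimension a linear form has small mean square on a ball, and Chebyshev's inequality
makes the Hilbert–Schmidt norm of `S_z` at most `1 / 2` on half of the disc; in low codimension a
smaller concentric disc does this (`smallProportion_mul_volume_ball_le`). The lower constant thus
depends on `d` alone.

No exact density formula is needed. Charts that are almost isometric near their centre give measure
comparisons up to fixed factors, collected in `TubeEstimate`, which add up over a disjoint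
decomposition of `M`. The normalizations of the Hausdorff measures are never computed: they sit in
one factor that cancels in `noisyLaw_comparable`. -/

noncomputable section

namespace TubeModel

/-! ### Nearest points and prolongation of minimizing segments -/

section

section Metric

variable {E : Type*} [NormedAddCommGroup E]

open Filter Topology in
/-- A nearest-point map onto a compact set is continuous at each point with a unique nearest
point. -/
theorem tendsto_nearest {M : Set E} (hM : IsCompact M) {p : E → E} (hpM : ∀ x, p x ∈ M)
    (hp : ∀ x, dist x (p x) = Metric.infDist x M) {x : E}
    (hx : ∃! y, y ∈ M ∧ dist x y = Metric.infDist x M) : Tendsto p (𝓝 x) (𝓝 (p x)) := by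
  -- By compactness it suffices that every cluster value of `p` at `x` is a nearest point of `x`.
  refine hM.tendsto_nhds_of_unique_mapClusterPt (Eventually.of_forall hpM) fun v hv hcl => ?_
  refine hx.unique ⟨hv, ?_⟩ ⟨hpM x, hp x⟩
  have h1 : MapClusterPt (dist x v) (𝓝 x) ((fun w => dist x w) ∘ p) :=
    hcl.continuousAt_comp (Continuous.continuousAt (by fun_prop))
  -- The triangle inequality squeezes `dist x (p y)` between `infDist y M ∓ dist x y`.
  have h2 : Tendsto (fun y => dist x (p y)) (𝓝 x) (𝓝 (Metric.infDist x M)) := by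
    have ha : Tendsto (fun y => Metric.infDist y M - dist x y) (𝓝 x)
        (𝓝 (Metric.infDist x M - dist x x)) :=
      Continuous.tendsto ((Metric.continuous_infDist_pt M).sub (by fun_prop)) x
    have hb : Tendsto (fun y => Metric.infDist y M + dist x y) (𝓝 x)
        (𝓝 (Metric.infDist x M + dist x x)) :=
      Continuous.tendsto ((Metric.continuous_infDist_pt M).add (by fun_prop)) x
    rw [dist_self, sub_zero] at ha
    rw [dist_self, add_zero] at hb
    refine tendsto_of_tendsto_of_tendsto_of_le_of_le ha hb (fun y => ?_) (fun y => ?_)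
    · have := dist_triangle y x (p y)
      rw [hp y, dist_comm y x] at this
      simp only
      linarith
    · have := dist_triangle x y (p y)
      rw [hp y] at this
      simp only
      linarith
  have h3 := h1.clusterPt.mono (show map (fun y => dist x (p y)) (𝓝 x) ≤ _ from h2)
  exact eq_of_nhds_neBot h3

variable [InnerProductSpace ℝ E]

open Filter Topology in
/-- If every point near `x₀ ∉ M` has a unique nearest point, the segment from the nearest point `u`
of `x₀` to `x₀` can be prolonged past `x₀` as a minimizing segment: the maximizer of the distance
to `M` on a small closed ball around `x₀` lies on its prolongation. -/
theorem infDist_extend [ProperSpace E] {M : Set E} (hM : IsCompact M) (hne : M.Nonempty) {κ : ℝ}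
    (hU : ∀ x, Metric.infDist x M < κ → ∃! y, y ∈ M ∧ dist x y = Metric.infDist x M)
    {x u : E} (hu : u ∈ M) {t s : ℝ} (ht : 0 < t) (hxu : dist x u = t)
    (hx : Metric.infDist x M = t) (hs : 0 < s) (hst : s ≤ t) (hsκ : t + s < κ) :
    Metric.infDist (u + ((t + s) / t) • (x - u)) M = t + s := by
  have hex : ∀ z, ∃ y ∈ M, dist z y = Metric.infDist z M := fun z => by
    obtain ⟨y, hy, h⟩ := hM.exists_infDist_eq_dist hne z
    exact ⟨y, hy, h.symm⟩
  choose p hpM hp using hex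
  obtain ⟨y, hyb, hmax⟩ := (isCompact_closedBall x s).exists_isMaxOn
    (Metric.nonempty_closedBall.2 hs.le) (Metric.continuous_infDist_pt M).continuousOn
  have hle : ∀ z, Metric.infDist z M ≤ t + dist z x := fun z => by
    rw [← hx]; exact Metric.infDist_le_infDist_add_dist
  have hyx : dist y x ≤ s := hyb
  have hyκ : Metric.infDist y M < κ := by linarith [hle y]
  have hpt := tendsto_nearest hM hpM hp (hU y hyκ)
  set r := Metric.infDist y M with hr
  have htr : t ≤ r := hx ▸ hmax (Metric.mem_closedBall_self hs.le)
  have hr0 : 0 < r := ht.trans_le htr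
  -- First-order condition at the maximum `y`. Moving towards `z` does not increase the distance to
  -- `M`, and the foot of the moved point is at distance at least `r` from `y`; expanding the square
  -- and letting `ε → 0` uses continuity of `p` at `y`.
  have key : ∀ z ∈ Metric.closedBall x s, inner ℝ (z - y) (y - p y) ≤ 0 := by
    intro z hz
    have hlim : Tendsto (fun ε : ℝ => y + ε • (z - y)) (𝓝[>] 0) (𝓝 y) := by
      have : Tendsto (fun ε : ℝ => y + ε • (z - y)) (𝓝 0) (𝓝 (y + (0 : ℝ) • (z - y))) :=
        Continuous.tendsto (by fun_prop) 0
      rw [zero_smul, add_zero] at this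
      exact this.mono_left nhdsWithin_le_nhds
    have hlim2 : Tendsto (fun ε : ℝ => inner ℝ (z - y) (y - p (y + ε • (z - y)))) (𝓝[>] 0)
        (𝓝 (inner ℝ (z - y) (y - p y))) :=
      tendsto_const_nhds.inner (tendsto_const_nhds.sub (hpt.comp hlim))
    refine le_of_tendsto hlim2 ?_
    filter_upwards [Ioc_mem_nhdsGT (zero_lt_one (α := ℝ))] with ε hε
    have hmem : y + ε • (z - y) ∈ Metric.closedBall x s :=
      (convex_closedBall x s).add_smul_sub_mem hyb hz ⟨hε.1.le, hε.2⟩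
    have h1 : Metric.infDist (y + ε • (z - y)) M ≤ r := hmax hmem
    have h2 : r ≤ dist y (p (y + ε • (z - y))) := Metric.infDist_le_dist_of_mem (hpM _)
    rw [← hp] at h1
    have h3 : ‖(y - p (y + ε • (z - y))) + ε • (z - y)‖ ^ 2 ≤
        ‖y - p (y + ε • (z - y))‖ ^ 2 := by
      rw [dist_eq_norm] at h1 h2
      have : (y - p (y + ε • (z - y))) + ε • (z - y) =
        y + ε • (z - y) - p (y + ε • (z - y)) := by abel
      rw [this]
      exact pow_le_pow_left₀ (norm_nonneg _) (h1.trans h2) 2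
    rw [norm_add_sq_real, inner_smul_right, real_inner_comm] at h3
    have h4 : ε * inner ℝ (z - y) (y - p (y + ε • (z - y))) ≤ 0 := by
      nlinarith [sq_nonneg ‖ε • (z - y)‖]
    exact nonpos_of_mul_nonpos_right h4 hε.1
  have hyp : ‖y - p y‖ = r := by rw [← dist_eq_norm, hp]
  -- The point of the ball furthest in the direction `y - p y` is the test point that forces `y`
  -- itself to be that point.
  have hz : x + (s / r) • (y - p y) ∈ Metric.closedBall x s := by
    rw [Metric.mem_closedBall, dist_eq_norm, add_sub_cancel_left, norm_smul, hyp,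
      Real.norm_of_nonneg (by positivity), div_mul_cancel₀ _ hr0.ne']
  have hk := key _ hz
  have h5 : s * r ≤ inner ℝ (y - x) (y - p y) := by
    have : x + (s / r) • (y - p y) - y = (s / r) • (y - p y) - (y - x) := by abel
    rw [this, inner_sub_left, inner_smul_left, real_inner_self_eq_norm_sq, hyp] at hk
    have h6 : (s / r) * r ^ 2 = s * r := by field_simp
    simp only [conj_trivial, h6] at hk
    linarith
  -- Equality case of Cauchy–Schwarz: `‖y - x‖ ≤ s`, `‖y - p y‖ = r` and the inner product is at
  -- least `s * r`.
  have h7 : y - x = (s / r) • (y - p y) := by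
    rw [← sub_eq_zero, ← norm_eq_zero, ← sq_eq_zero_iff]
    refine le_antisymm ?_ (sq_nonneg _)
    rw [norm_sub_sq_real, inner_smul_right, norm_smul, hyp, Real.norm_of_nonneg (by positivity),
      div_mul_cancel₀ _ hr0.ne']
    rw [dist_eq_norm] at hyx
    have h8 : ‖y - x‖ ^ 2 ≤ s ^ 2 := pow_le_pow_left₀ (norm_nonneg _) hyx 2
    have h9 : s / r * (s * r) ≤ s / r * inner ℝ (y - x) (y - p y) := by gcongr
    have h10 : s / r * (s * r) = s ^ 2 := by field_simp
    linarith
  have h8 : x - p y = ((r - s) / r) • (y - p y) := by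
    have : x - p y = (y - p y) - (y - x) := by abel
    rw [this, h7, sub_div, div_self hr0.ne', sub_smul, one_smul]
  have hsr : 0 ≤ r - s := by linarith
  have h9 : dist x (p y) = r - s := by
    rw [dist_eq_norm, h8, norm_smul, hyp, Real.norm_of_nonneg (by positivity),
      div_mul_cancel₀ _ hr0.ne']
  -- Now `x` lies on the segment from `p y` to `y`, at distance `r - s` from `p y`. Since `r ≤ t +
  -- s`, the point `p y` is nearest to `x`, hence equals `u`.
  have h10 : t = r - s := by
    refine le_antisymm ?_ (by linarith [hle y])
    rw [← h9, ← hx]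
    exact Metric.infDist_le_dist_of_mem (hpM y)
  have h11 : p y = u :=
    (hU x (by linarith)).unique ⟨hpM y, by rw [h9, hx, h10]⟩ ⟨hu, by rw [hxu, hx]⟩
  have h12 : u + ((t + s) / t) • (x - u) = y := by
    have h13 : r = t + s := by linarith
    rw [← h11, h8, smul_smul, ← h10, ← h13]
    have : r / t * (t / r) = 1 := by field_simp
    rw [this, one_smul]; abel
  rw [h12, ← hr]; linarith

/-- If a normal segment at `u` is minimizing for a short time, then it is minimizing up to the
reach. -/
theorem infDist_add_of_small [ProperSpace E] {M : Set E} (hM : IsCompact M) {κ : ℝ}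
    (hU : ∀ x, Metric.infDist x M < κ → ∃! y, y ∈ M ∧ dist x y = Metric.infDist x M)
    {u z : E} (hu : u ∈ M) {δ : ℝ} (hδ : 0 < δ)
    (hz : Metric.infDist (u + δ • z) M = δ * ‖z‖) (hzκ : ‖z‖ < κ) :
    Metric.infDist (u + z) M = ‖z‖ := by
  rcases eq_or_ne z 0 with rfl | hz0
  · simpa using Metric.infDist_zero_of_mem hu
  have hzp : 0 < ‖z‖ := norm_pos_iff.2 hz0
  have down : ∀ a b : ℝ, 0 ≤ a → a ≤ b → Metric.infDist (u + b • z) M = b * ‖z‖ →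
      Metric.infDist (u + a • z) M = a * ‖z‖ := by
    intro a b ha hab hb
    apply le_antisymm
    · refine (Metric.infDist_le_dist_of_mem hu).trans ?_
      rw [dist_eq_norm, add_sub_cancel_left, norm_smul, Real.norm_of_nonneg ha]
    · have := Metric.infDist_le_infDist_add_dist (s := M) (x := u + b • z) (y := u + a • z)
      rw [hb, dist_eq_norm, add_sub_add_left_eq_sub, ← sub_smul, norm_smul,
        Real.norm_of_nonneg (by linarith)] at this
      linarith
  -- One prolongation can at most double the length, because `infDist_extend` requires `s ≤ t`; so
  -- the factor is doubled repeatedly and capped at one.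
  have step : ∀ j : ℕ, Metric.infDist (u + (min (2 ^ j * δ) 1) • z) M =
      (min (2 ^ j * δ) 1) * ‖z‖ := by
    intro j
    induction j with
    | zero => exact down _ δ (by positivity) (by simp) hz
    | succ j ih =>
      set a := min (2 ^ j * δ) 1 with ha
      have ha0 : 0 < a := by positivity
      set b := min (2 ^ (j + 1) * δ) 1 with hb
      have hab : a ≤ b := min_le_min_right _ (by gcongr <;> norm_num)
      have hba : b ≤ 2 * a := by
        rw [ha, hb, mul_min_of_nonneg _ _ (by norm_num : (0 : ℝ) ≤ 2)]
        exact min_le_min (by rw [pow_succ]; linarith) (by norm_num)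
      have hb1 : b ≤ 1 := min_le_right _ _
      rcases hab.eq_or_lt with h | h
      · rw [← h]; exact ih
      have := infDist_extend hM ⟨u, hu⟩ hU (x := u + a • z) hu (t := a * ‖z‖)
        (s := (b - a) * ‖z‖) (by positivity)
        (by rw [dist_eq_norm, add_sub_cancel_left, norm_smul, Real.norm_of_nonneg ha0.le]) ih
        (mul_pos (by linarith) hzp) (by gcongr; linarith) (by nlinarith)
      have h2 : (a * ‖z‖ + (b - a) * ‖z‖) / (a * ‖z‖) = b / a := by field_simp; ring
      rw [h2, add_sub_cancel_left, smul_smul, div_mul_cancel₀ _ ha0.ne'] at this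
      rw [this]; ring
  obtain ⟨j, hj⟩ := pow_unbounded_of_one_lt (1 / δ) (one_lt_two (α := ℝ))
  have h := step j
  rw [min_eq_right, one_smul, one_mul] at h
  · exact h
  · rw [div_lt_iff₀ hδ] at hj; exact hj.le

end Metric

end

/-! ### Straightening charts and normal charts -/

section

section Charts

variable {A C E : Type*} [NormedAddCommGroup A] [InnerProductSpace ℝ A]
  [NormedAddCommGroup C] [InnerProductSpace ℝ C] [NormedAddCommGroup E] [InnerProductSpace ℝ E]

/-- Local coordinates on `M` and on its normal spaces near `p`: a parametrization `ψ` of `M` with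
inverse `ρ`, and linear parametrizations `n a` of the normal spaces at `ψ a`, both isometric to
first order at `p = ψ 0`. -/
structure NormalChart (A C : Type*) {E : Type*} [NormedAddCommGroup A] [InnerProductSpace ℝ A]
    [NormedAddCommGroup C] [InnerProductSpace ℝ C] [NormedAddCommGroup E] [InnerProductSpace ℝ E]
    (M : Set E) (p : E) where
  U : Set A
  W : Set E
  ψ : A → E
  n : A → C →L[ℝ] E
  ρ : E → A
  isOpen_U : IsOpen U
  isOpen_W : IsOpen W
  zero_mem : 0 ∈ U
  ψ_zero : ψ 0 = p
  ψ_mem : ∀ a ∈ U, ψ a ∈ M ∩ W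
  ρ_mem : ∀ x ∈ M ∩ W, ρ x ∈ U
  ψ_ρ : ∀ x ∈ M ∩ W, ψ (ρ x) = x
  ρ_ψ : ∀ a ∈ U, ρ (ψ a) = a
  continuousOn_ρ : ContinuousOn ρ W
  contDiffOn_ψ : ContDiffOn ℝ 1 ψ U
  contDiffOn_n : ContDiffOn ℝ 1 n U
  range_n : ∀ a ∈ U, (n a).range = (Submodule.span ℝ (tangentConeAt ℝ M (ψ a)))ᗮ
  injective_n : ∀ a ∈ U, Function.Injective (n a)
  norm_fderiv_ψ : ∀ ξ, ‖fderiv ℝ ψ 0 ξ‖ = ‖ξ‖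
  norm_n_zero : ∀ c, ‖n 0 c‖ = ‖c‖
  inner_fderiv_n : ∀ ξ c, inner ℝ (fderiv ℝ ψ 0 ξ) (n 0 c) = 0
  symm : ∀ ξ η c, inner ℝ (fderiv ℝ n 0 ξ c) (fderiv ℝ ψ 0 η) =
    inner ℝ (fderiv ℝ n 0 η c) (fderiv ℝ ψ 0 ξ)

variable {M : Set E} {Θ : OpenPartialHomeomorph E (A × C)}

lemma hasFDerivAt_straight (h1 : ContDiffOn ℝ ∞ Θ Θ.source) {x : E} (hx : x ∈ Θ.source) :
    HasFDerivAt Θ (fderiv ℝ Θ x) x :=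
  ((h1.contDiffAt (Θ.open_source.mem_nhds hx)).differentiableAt (by simp)).hasFDerivAt

lemma hasFDerivAt_straight_symm (h2 : ContDiffOn ℝ ∞ Θ.symm Θ.target)
    {y : A × C} (hy : y ∈ Θ.target) :
    HasFDerivAt Θ.symm (fderiv ℝ Θ.symm y) y :=
  ((h2.contDiffAt (Θ.open_target.mem_nhds hy)).differentiableAt (by simp)).hasFDerivAt

lemma fderiv_symm_fderiv (h1 : ContDiffOn ℝ ∞ Θ Θ.source)
    (h2 : ContDiffOn ℝ ∞ Θ.symm Θ.target) {x : E} (hx : x ∈ Θ.source) (v : E) :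
    fderiv ℝ Θ.symm (Θ x) (fderiv ℝ Θ x v) = v := by
  have h := (hasFDerivAt_straight_symm h2 (Θ.map_source hx)).comp x (hasFDerivAt_straight h1 hx)
  have h' : HasFDerivAt (Θ.symm ∘ Θ) (ContinuousLinearMap.id ℝ E) x :=
    (hasFDerivAt_id x).congr_of_eventuallyEq (by
      filter_upwards [Θ.open_source.mem_nhds hx] with y hy using Θ.left_inv hy)
  exact congrArg (fun T : E →L[ℝ] E => T v) (h.unique h')

lemma fderiv_fderiv_symm (h1 : ContDiffOn ℝ ∞ Θ Θ.source)
    (h2 : ContDiffOn ℝ ∞ Θ.symm Θ.target) {x : E} (hx : x ∈ Θ.source) (w : A × C) :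
    fderiv ℝ Θ x (fderiv ℝ Θ.symm (Θ x) w) = w := by
  have hy := Θ.map_source hx
  have h0 := hasFDerivAt_straight h1 hx
  rw [← Θ.left_inv hx] at h0
  have h := h0.comp (Θ x) (hasFDerivAt_straight_symm h2 hy)
  have h' : HasFDerivAt (Θ ∘ Θ.symm) (ContinuousLinearMap.id ℝ (A × C)) (Θ x) :=
    (hasFDerivAt_id _).congr_of_eventuallyEq (by
      filter_upwards [Θ.open_target.mem_nhds hy] with y hy using Θ.right_inv hy)
  have := congrArg (fun T : (A × C) →L[ℝ] (A × C) => T w) (h.unique h')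
  simpa [Θ.left_inv hx] using this

/-- In a straightening chart the tangent space is the kernel of the differential of the normal
coordinates. -/
lemma span_tangentConeAt_eq_ker (h1 : ContDiffOn ℝ ∞ Θ Θ.source)
    (h2 : ContDiffOn ℝ ∞ Θ.symm Θ.target)
    (h3 : ∀ x ∈ Θ.source, x ∈ M ↔ (Θ x).2 = 0)
    {x : E} (hx : x ∈ Θ.source) (hxM : x ∈ M) :
    Submodule.span ℝ (tangentConeAt ℝ M x) =
      ((ContinuousLinearMap.snd ℝ A C).comp (fderiv ℝ Θ x)).ker := by
  apply le_antisymm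
  · rw [Submodule.span_le]
    intro v hv
    have hF : HasFDerivWithinAt (fun y => (Θ y).2)
        ((ContinuousLinearMap.snd ℝ A C).comp (fderiv ℝ Θ x)) (M ∩ Θ.source) x :=
      ((ContinuousLinearMap.snd ℝ A C).hasFDerivAt.comp x
        (hasFDerivAt_straight h1 hx)).hasFDerivWithinAt
    rw [← tangentConeAt_inter_nhds (Θ.open_source.mem_nhds hx)] at hv
    have h := hF.mapsTo_tangent_cone hv
    have hsub : (fun y => (Θ y).2) '' (M ∩ Θ.source) ⊆ {0} := by
      rintro _ ⟨y, hy, rfl⟩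
      exact (h3 y hy.2).1 hy.1
    have h4 := tangentConeAt_mono hsub h
    have h5 := tangentConeAt_subset_zero (𝕜 := ℝ) (s := ({0} : Set C)) (x := (Θ x).2) (by
      rw [accPt_principal_iff_nhdsWithin, (h3 x hx).1 hxM]
      simp) h4
    exact h5
  · intro v hv
    have hv0 : (fderiv ℝ Θ x v).2 = 0 := hv
    set y := Θ x with hy
    have hyt : y ∈ Θ.target := Θ.map_source hx
    have hy2 : y.2 = 0 := (h3 x hx).1 hxM
    have hyy : (y.1, (0 : C)) = y := by rw [← hy2]
    let V : Set A := (fun a => (a, (0 : C))) ⁻¹' Θ.target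
    have hV : V ∈ nhds y.1 := (Θ.open_target.preimage (by fun_prop)).mem_nhds (by
      change (y.1, (0 : C)) ∈ Θ.target
      rwa [hyy])
    -- Conversely, a kernel vector is the image of its first component under the differential of the
    -- parametrization `a ↦ Θ.symm (a, 0)` of `M`.
    have hh : HasFDerivAt (fun a => Θ.symm (a, (0 : C)))
        ((fderiv ℝ Θ.symm y).comp (ContinuousLinearMap.inl ℝ A C)) y.1 := by
      have := hasFDerivAt_straight_symm h2 hyt
      rw [← hyy] at this
      have h' := this.comp y.1 (ContinuousLinearMap.inl ℝ A C).hasFDerivAt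
      rw [hyy] at h'
      exact h'
    apply Submodule.subset_span
    have hmem : (fderiv ℝ Θ x v).1 ∈ tangentConeAt ℝ V y.1 := by
      rw [tangentConeAt_of_mem_nhds hV]; trivial
    have h := (hh.hasFDerivWithinAt (s := V)).mapsTo_tangent_cone hmem
    have e1 : ((fderiv ℝ Θ.symm y).comp (ContinuousLinearMap.inl ℝ A C)) (fderiv ℝ Θ x v).1 = v := by
      have : ((fderiv ℝ Θ x v).1, (0 : C)) = fderiv ℝ Θ x v := by rw [← hv0]
      simp only [ContinuousLinearMap.comp_apply, ContinuousLinearMap.inl_apply, this]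
      exact fderiv_symm_fderiv h1 h2 hx v
    rw [e1] at h
    have e2 : Θ.symm (y.1, (0 : C)) = x := by rw [hyy, hy, Θ.left_inv hx]
    simp only [e2] at h
    refine tangentConeAt_mono ?_ h
    rintro _ ⟨a, ha, rfl⟩
    rw [h3 _ (Θ.map_target ha), Θ.right_inv ha]

/-- An injective linear map becomes isometric after a linear change of variables. -/
lemma exists_equiv_norm_eq [FiniteDimensional ℝ A] (T : A →L[ℝ] E) (hT : Function.Injective T) :
    ∃ L : A ≃L[ℝ] A, ∀ a, ‖T (L a)‖ = ‖a‖ := by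
  let e0 : A ≃ₗ[ℝ] LinearMap.range (T : A →ₗ[ℝ] E) := LinearEquiv.ofInjective _ hT
  let e1 : A ≃ₗᵢ[ℝ] LinearMap.range (T : A →ₗ[ℝ] E) :=
    (stdOrthonormalBasis ℝ A).equiv (stdOrthonormalBasis ℝ _) (finCongr e0.finrank_eq)
  refine ⟨(e1.toLinearEquiv.trans e0.symm).toContinuousLinearEquiv, fun a => ?_⟩
  have : T ((e1.toLinearEquiv.trans e0.symm).toContinuousLinearEquiv a) = e1 a := by
    have h := congrArg Subtype.val (e0.apply_symm_apply (e1 a))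
    exact h
  rw [this]
  exact (Submodule.coe_norm _).symm.trans (e1.norm_map a)

section

variable [FiniteDimensional ℝ E]

/-- Linear coordinates `E ≃ A × C` that are isometric for the `ℓ²` norm on the product. -/
def IsOrthogonalSplitting (j : E ≃L[ℝ] A × C) : Prop :=
  ∀ x, ‖x‖ ^ 2 = ‖(j x).1‖ ^ 2 + ‖(j x).2‖ ^ 2

/-- The orthogonal frame of a normal chart at its centre. -/
lemma NormalChart.exists_frame {p : E} (N : NormalChart A C M p) {j : E ≃L[ℝ] A × C}
    (hj : IsOrthogonalSplitting j) :
    ∃ O : E ≃ₗᵢ[ℝ] E, ∀ x, O x = fderiv ℝ N.ψ 0 (j x).1 + N.n 0 (j x).2 := by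
  let O₀ : E →ₗ[ℝ] E := ((fderiv ℝ N.ψ 0).comp (ContinuousLinearMap.fst ℝ A C) +
    (N.n 0).comp (ContinuousLinearMap.snd ℝ A C)).comp (j : E →L[ℝ] A × C)
  have hO : ∀ x, O₀ x = fderiv ℝ N.ψ 0 (j x).1 + N.n 0 (j x).2 := fun x => rfl
  let O₁ : E →ₗᵢ[ℝ] E := ⟨O₀, fun x => by
    rw [← sq_eq_sq₀ (norm_nonneg _) (norm_nonneg _), hj x, hO, norm_add_sq_real,
      N.inner_fderiv_n, N.norm_fderiv_ψ, N.norm_n_zero]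
    ring⟩
  exact ⟨O₁.toLinearIsometryEquiv rfl, fun x => rfl⟩

/-- The vector from a nearest point `p ∈ M` of `y` to `y` is normal to `M`. -/
lemma NormalChart.sub_mem_normal {p : E} (N : NormalChart A C M p) {j : E ≃L[ℝ] A × C}
    (hj : IsOrthogonalSplitting j) {y : E} (hy : dist y p = Metric.infDist y M) :
    y - p ∈ (Submodule.span ℝ (tangentConeAt ℝ M p))ᗮ := by
  obtain ⟨O, hO⟩ := N.exists_frame hj
  have hψ : HasFDerivAt N.ψ (fderiv ℝ N.ψ 0) 0 :=
    ((N.contDiffOn_ψ.contDiffAt (N.isOpen_U.mem_nhds N.zero_mem)).differentiableAt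
      (by simp)).hasFDerivAt
  -- The squared distance from `y` to `M` is minimal at the centre of the chart; its vanishing
  -- derivative is the orthogonality sought.
  have hmin : IsLocalMin (fun a => ‖y - N.ψ a‖ ^ 2) 0 := by
    filter_upwards [N.isOpen_U.mem_nhds N.zero_mem] with a ha
    rw [N.ψ_zero, ← dist_eq_norm, ← dist_eq_norm, hy]
    exact pow_le_pow_left₀ Metric.infDist_nonneg
      (Metric.infDist_le_dist_of_mem (N.ψ_mem a ha).1) 2
  have hd := (hψ.const_sub y).norm_sq
  have h0 := hmin.hasFDerivAt_eq_zero hd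
  have hperp : ∀ ξ, inner ℝ (y - p) (fderiv ℝ N.ψ 0 ξ) = 0 := by
    intro ξ
    have := congrArg (fun T : A →L[ℝ] ℝ => T ξ) h0
    simp [N.ψ_zero, inner_sub_left] at this ⊢
    linarith
  rw [← N.ψ_zero, ← N.range_n 0 N.zero_mem, N.ψ_zero]
  obtain ⟨x, hx⟩ := O.surjective (y - p)
  rw [hO] at hx
  have h1 := hperp (j x).1
  rw [← hx, inner_add_left, real_inner_self_eq_norm_sq, N.norm_fderiv_ψ,
    real_inner_comm, N.inner_fderiv_n, add_zero, sq_eq_zero_iff, norm_eq_zero] at h1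
  rw [← hx, h1, map_zero, zero_add]
  exact ⟨(j x).2, rfl⟩

end

variable [FiniteDimensional ℝ C] [FiniteDimensional ℝ E]

/-- The adjoint as a real linear map. -/
def adjointL : (E →L[ℝ] C) →L[ℝ] (C →L[ℝ] E) :=
  LinearMap.toContinuousLinearMap
    { toFun := fun T => ContinuousLinearMap.adjoint T
      map_add' := fun S T => map_add _ S T
      map_smul' := fun r T => by simp }

lemma inner_adjointL_left (T : E →L[ℝ] C) (c : C) (x : E) :
    inner ℝ (adjointL T c) x = inner ℝ c (T x) :=
  ContinuousLinearMap.adjoint_inner_left T x c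


/-- Short normal segments are minimizing. -/
theorem exists_infDist_normal (h1 : ContDiffOn ℝ ∞ Θ Θ.source)
    (h2 : ContDiffOn ℝ ∞ Θ.symm Θ.target) (h3 : ∀ x ∈ Θ.source, x ∈ M ↔ (Θ x).2 = 0) {p : E}
    (hp : p ∈ Θ.source) (hpM : p ∈ M) {z : E}
    (hz : z ∈ (Submodule.span ℝ (tangentConeAt ℝ M p))ᗮ) :
    ∃ δ > 0, Metric.infDist (p + δ • z) M = δ * ‖z‖ := by
  let F : E → C := fun x => (Θ x).2
  have hFd : ∀ x ∈ Θ.source,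
      HasFDerivAt F ((ContinuousLinearMap.snd ℝ A C).comp (fderiv ℝ Θ x)) x := fun x hx =>
    (ContinuousLinearMap.snd ℝ A C).hasFDerivAt.comp x (hasFDerivAt_straight h1 hx)
  have hFs : ContDiffOn ℝ ∞ F Θ.source := contDiff_snd.comp_contDiffOn h1
  have hF' : ContDiffOn ℝ ∞ (fderiv ℝ F) Θ.source :=
    hFs.fderiv_of_isOpen Θ.open_source (by simp)
  -- The normal space is the range of the adjoint of the differential of `F`, so `z` is the image of
  -- some `c`.
  rw [span_tangentConeAt_eq_ker h1 h2 h3 hp hpM, ← (hFd _ hp).fderiv,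
    ContinuousLinearMap.orthogonal_ker,
    (Submodule.closed_of_finiteDimensional _).submodule_topologicalClosure_eq] at hz
  obtain ⟨c, hc⟩ := hz
  have hO := ((hF'.contDiffAt (Θ.open_source.mem_nhds hp)).differentiableAt
    (by simp)).hasFDerivAt.isBigO_sub
  obtain ⟨K, hK0, hK⟩ := hO.exists_pos
  rw [Asymptotics.IsBigOWith] at hK
  obtain ⟨r, hr, hball⟩ := Metric.eventually_nhds_iff_ball.1
    (hK.and (Θ.open_source.mem_nhds hp))
  -- `F` vanishes at `p` and at `v`, so its differential at `p` is quadratically small on `v - p`;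
  -- this carries over to `z` by the adjoint.
  have near : ∀ v ∈ M, v ∈ Metric.ball p r → inner ℝ z (v - p) ≤ ‖c‖ * K * ‖v - p‖ ^ 2 := by
    intro v hvM hv
    have hsub : Metric.closedBall p ‖v - p‖ ⊆ Metric.ball p r :=
      Metric.closedBall_subset_ball (by rwa [← dist_eq_norm])
    have h := (convex_closedBall p ‖v - p‖).norm_image_sub_le_of_norm_hasFDerivWithin_le'
      (f := F) (f' := fderiv ℝ F) (φ := fderiv ℝ F p) (C := K * ‖v - p‖) (x := p) (y := v)
      (fun x hx => by
        rw [(hFd _ (hball x (hsub hx)).2).fderiv]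
        exact (hFd _ (hball x (hsub hx)).2).hasFDerivWithinAt)
      (fun x hx => (hball x (hsub hx)).1.trans (by
        rw [Metric.mem_closedBall, dist_eq_norm] at hx
        gcongr)) (by simp) (by simp [dist_eq_norm])
    have e1 : F v = 0 := (h3 v (hball v hv).2).1 hvM
    have e2 : F p = 0 := (h3 p hp).1 hpM
    rw [e1, e2, sub_zero, zero_sub, norm_neg] at h
    have e3 : inner ℝ z (v - p) = inner ℝ c (fderiv ℝ F p (v - p)) := by
      rw [← hc]; exact inner_adjointL_left _ _ _
    rw [e3]
    calc _ ≤ ‖c‖ * ‖fderiv ℝ F p (v - p)‖ := real_inner_le_norm _ _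
      _ ≤ ‖c‖ * (K * ‖v - p‖ * ‖v - p‖) := by gcongr
      _ = _ := by ring
  -- With `δ = 1 / b`, the first summand makes the cross term at most `‖v - p‖ ^ 2` for `v` near
  -- `p`; the second gives `2 * δ * ‖z‖ ≤ r`, which settles `v` outside the ball.
  set b := 2 * ‖c‖ * K + 2 * ‖z‖ / r + 1 with hb
  have hb0 : 0 < b := by positivity
  refine ⟨1 / b, by positivity, le_antisymm ?_ ?_⟩
  · refine (Metric.infDist_le_dist_of_mem hpM).trans ?_
    rw [dist_eq_norm, add_sub_cancel_left, norm_smul, Real.norm_of_nonneg (by positivity)]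
  · refine (Metric.le_infDist ⟨p, hpM⟩).2 fun v hv => ?_
    set δ := 1 / b with hδ
    have hδ0 : 0 < δ := by positivity
    have hδb : δ * b = 1 := by rw [hδ]; field_simp
    have hnorm : ‖δ • z‖ = δ * ‖z‖ := by rw [norm_smul, Real.norm_of_nonneg hδ0.le]
    have hdist : dist (p + δ • z) v = ‖δ • z - (v - p)‖ := by
      rw [dist_eq_norm]; congr 1; abel
    rw [hdist]
    by_cases hvr : v ∈ Metric.ball p r
    · have h := near v hv hvr
      rw [← hnorm]
      refine le_of_sq_le_sq ?_ (norm_nonneg _)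
      rw [norm_sub_sq_real, inner_smul_left, conj_trivial]
      have h5 : 2 * (δ * inner ℝ z (v - p)) ≤ ‖v - p‖ ^ 2 := by
        calc _ ≤ 2 * (δ * (‖c‖ * K * ‖v - p‖ ^ 2)) := by gcongr
          _ = (δ * (2 * ‖c‖ * K)) * ‖v - p‖ ^ 2 := by ring
          _ ≤ (δ * b) * ‖v - p‖ ^ 2 := by
            gcongr
            have : 0 ≤ 2 * ‖z‖ / r := by positivity
            linarith
          _ = _ := by rw [hδb, one_mul]
      linarith
    · rw [Metric.mem_ball, not_lt, dist_eq_norm] at hvr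
      have h6 := norm_sub_norm_le (v - p) (δ • z)
      rw [norm_sub_rev (v - p)] at h6
      rw [hnorm] at h6
      have h7 : 2 * (δ * ‖z‖) ≤ r := by
        have h8 : δ * (2 * ‖z‖ / r) ≤ δ * b := by
          gcongr
          have : 0 ≤ 2 * ‖c‖ * K := by positivity
          linarith
        rw [hδb, mul_div_assoc', div_le_one hr] at h8
        linarith
      linarith

variable [FiniteDimensional ℝ A]

/-- A straightening diffeomorphism yields a normal chart. -/
theorem exists_normalChart (h1 : ContDiffOn ℝ ∞ Θ Θ.source)
    (h2 : ContDiffOn ℝ ∞ Θ.symm Θ.target) (h3 : ∀ x ∈ Θ.source, x ∈ M ↔ (Θ x).2 = 0) {p : E}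
    (hp : p ∈ Θ.source) (hpM : p ∈ M) : Nonempty (NormalChart A C M p) := by
  have hq : ((Θ p).1, (0 : C)) = Θ p := by rw [← (h3 p hp).1 hpM]
  set T : A →L[ℝ] E := (fderiv ℝ Θ.symm (Θ p)).comp (ContinuousLinearMap.inl ℝ A C) with hT
  let F : E → C := fun x => (Θ x).2
  have hFd : ∀ x ∈ Θ.source,
      HasFDerivAt F ((ContinuousLinearMap.snd ℝ A C).comp (fderiv ℝ Θ x)) x := fun x hx =>
    (ContinuousLinearMap.snd ℝ A C).hasFDerivAt.comp x (hasFDerivAt_straight h1 hx)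
  have hFs : ContDiffOn ℝ ∞ F Θ.source := contDiff_snd.comp_contDiffOn h1
  have hadj : ∀ x ∈ Θ.source, Function.Injective (adjointL (fderiv ℝ F x)) := by
    intro x hx
    rw [injective_iff_map_eq_zero]
    intro c hc
    have h := inner_adjointL_left (fderiv ℝ F x) c (fderiv ℝ Θ.symm (Θ x) (0, c))
    rw [hc, inner_zero_left, (hFd x hx).fderiv, ContinuousLinearMap.comp_apply,
      fderiv_fderiv_symm h1 h2 hx] at h
    exact inner_self_eq_zero.1 h.symm
  have hTinj : Function.Injective T := by
    rw [injective_iff_map_eq_zero]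
    intro a ha
    have h := fderiv_fderiv_symm h1 h2 hp (a, 0)
    have h' : fderiv ℝ Θ.symm (Θ p) (a, 0) = 0 := ha
    rw [h', map_zero] at h
    exact (congrArg Prod.fst h).symm
  obtain ⟨L, hL⟩ := exists_equiv_norm_eq T hTinj
  obtain ⟨L', hL'⟩ := exists_equiv_norm_eq _ (hadj p hp)
  let e : A → A × C := fun a => ((Θ p).1 + L a, 0)
  have he : ContDiff ℝ ∞ e := by fun_prop
  let ψ : A → E := fun a => Θ.symm (e a)
  let U : Set A := e ⁻¹' Θ.target
  have he0 : e 0 = Θ p := by simp [e, hq]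
  have hψ0 : ψ 0 = p := by simp only [ψ, he0, Θ.left_inv hp]
  have hψs : ∀ a ∈ U, ψ a ∈ Θ.source := fun a ha => Θ.map_target ha
  have hψM : ∀ a ∈ U, ψ a ∈ M := fun a ha => by
    rw [h3 _ (hψs a ha)]
    simp only [ψ]
    rw [Θ.right_inv ha]
  have h0U : (0 : A) ∈ U := by
    change e 0 ∈ Θ.target
    rw [he0]; exact Θ.map_source hp
  have hU : IsOpen U := Θ.open_target.preimage he.continuous
  have hψc : ContDiffOn ℝ ∞ ψ U := h2.comp he.contDiffOn (fun a ha => ha)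
  have hψd : HasFDerivAt ψ (T.comp (L : A →L[ℝ] A)) 0 := by
    have h := hasFDerivAt_straight_symm h2 (Θ.map_source hp)
    rw [← he0] at h
    have h' : HasFDerivAt e ((ContinuousLinearMap.inl ℝ A C).comp (L : A →L[ℝ] A)) 0 :=
      ((L : A →L[ℝ] A).hasFDerivAt.const_add _).prodMk (hasFDerivAt_const (0 : C) (0 : A))
    have := h.comp 0 h'
    rw [he0] at this
    exact this
  have hF' : ContDiffOn ℝ ∞ (fderiv ℝ F) Θ.source :=
    hFs.fderiv_of_isOpen Θ.open_source (by simp)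
  -- The normal frame is the adjoint differential of the defining map `F`, precomposed with `L'` to
  -- be isometric at `p`.
  let P : (C →L[ℝ] E) →L[ℝ] (C →L[ℝ] E) :=
    (ContinuousLinearMap.compL ℝ C C E).flip (L' : C →L[ℝ] C)
  let n : A → C →L[ℝ] E := fun a => P (adjointL (fderiv ℝ F (ψ a)))
  have hn : ∀ a c, n a c = adjointL (fderiv ℝ F (ψ a)) (L' c) := fun a c => rfl
  have hnd : HasFDerivAt n (P.comp (adjointL.comp ((fderiv ℝ (fderiv ℝ F) p).comp
      (T.comp (L : A →L[ℝ] A))))) 0 := by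
    have h : HasFDerivAt (fderiv ℝ F) (fderiv ℝ (fderiv ℝ F) p) (ψ 0) := by
      rw [hψ0]
      exact ((hF'.contDiffAt (Θ.open_source.mem_nhds hp)).differentiableAt (by simp)).hasFDerivAt
    exact (P.comp adjointL).hasFDerivAt.comp 0 (h.comp 0 hψd)
  have hFT : ∀ a, fderiv ℝ F p (T a) = 0 := by
    intro a
    rw [(hFd p hp).fderiv]
    simp only [hT, ContinuousLinearMap.comp_apply]
    rw [fderiv_fderiv_symm h1 h2 hp]
    rfl
  exact ⟨{
    U := U
    W := Θ.source
    ψ := ψ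
    n := n
    ρ := fun x => L.symm ((Θ x).1 - (Θ p).1)
    isOpen_U := hU
    isOpen_W := Θ.open_source
    zero_mem := h0U
    ψ_zero := hψ0
    ψ_mem := fun a ha => ⟨hψM a ha, hψs a ha⟩
    ρ_mem := fun x hx => by
      change e _ ∈ Θ.target
      have : e (L.symm ((Θ x).1 - (Θ p).1)) = Θ x := by
        simp only [e, ContinuousLinearEquiv.apply_symm_apply, add_sub_cancel]
        rw [← (h3 x hx.2).1 hx.1]
      rw [this]; exact Θ.map_source hx.2
    ψ_ρ := fun x hx => by
      have : e (L.symm ((Θ x).1 - (Θ p).1)) = Θ x := by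
        simp only [e, ContinuousLinearEquiv.apply_symm_apply, add_sub_cancel]
        rw [← (h3 x hx.2).1 hx.1]
      simp only [ψ, this, Θ.left_inv hx.2]
    ρ_ψ := fun a ha => by
      simp only [ψ]
      rw [Θ.right_inv ha]
      simp [e]
    continuousOn_ρ := by
      have := Θ.continuousOn
      fun_prop
    contDiffOn_ψ := hψc.of_le (by simp)
    contDiffOn_n := by
      have h : ContDiffOn ℝ ∞ (fun a => fderiv ℝ F (ψ a)) U := hF'.comp hψc hψs
      exact ((P.comp adjointL).contDiff.comp_contDiffOn h).of_le (by simp)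
    range_n := fun a ha => by
      rw [span_tangentConeAt_eq_ker h1 h2 h3 (hψs a ha) (hψM a ha), ← (hFd _ (hψs a ha)).fderiv,
        ContinuousLinearMap.orthogonal_ker,
        (Submodule.closed_of_finiteDimensional _).submodule_topologicalClosure_eq]
      ext x
      constructor
      · rintro ⟨c, rfl⟩
        exact ⟨L' c, rfl⟩
      · rintro ⟨c, rfl⟩
        exact ⟨L'.symm c, by
          change n a (L'.symm c) = _
          rw [hn, L'.apply_symm_apply]; rfl⟩
    injective_n := fun a ha => by
      intro c c' h
      exact L'.injective (hadj _ (hψs a ha) h)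
    norm_fderiv_ψ := fun ξ => by rw [hψd.fderiv]; exact hL ξ
    norm_n_zero := fun c => by rw [hn, hψ0]; exact hL' c
    inner_fderiv_n := fun ξ c => by
      rw [hψd.fderiv, hn, hψ0, real_inner_comm, inner_adjointL_left,
        ContinuousLinearMap.comp_apply, hFT, inner_zero_right]
    -- Both sides pair `L' c` with the second derivative of `F` in two tangent directions, so the
    -- symmetry is that of second derivatives.
    symm := fun ξ η c => by
      rw [hnd.fderiv, hψd.fderiv]
      change inner ℝ (adjointL (fderiv ℝ (fderiv ℝ F) p (T (L ξ))) (L' c)) (T (L η)) =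
        inner ℝ (adjointL (fderiv ℝ (fderiv ℝ F) p (T (L η))) (L' c)) (T (L ξ))
      rw [inner_adjointL_left, inner_adjointL_left]
      have := (hFs.contDiffAt (Θ.open_source.mem_nhds hp)).isSymmSndFDerivAt
        (by simpa using (mod_cast le_top : ((2 : ℕ∞) : WithTop ℕ∞) ≤ (∞ : WithTop ℕ∞)))
      rw [this.eq] }⟩

end Charts

/-! ### From the reach to the tubular neighbourhood -/

section Euclidean

variable {d k : ℕ}

lemma finAddEquivProd_snd (x : EuclideanSpace ℝ (Fin (d + k))) (i : Fin k) :
    (EuclideanSpace.finAddEquivProd (n := d) (m := k) x).2 i = x (Fin.natAdd d i) := by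
  simp [EuclideanSpace.finAddEquivProd, EuclideanSpace.sumEquivProd]

lemma finAddEquivProd_fst (x : EuclideanSpace ℝ (Fin (d + k))) (i : Fin d) :
    (EuclideanSpace.finAddEquivProd (n := d) (m := k) x).1 i = x (Fin.castAdd k i) := by
  simp [EuclideanSpace.finAddEquivProd, EuclideanSpace.sumEquivProd]

/-- The product type carries the sup norm, so the splitting is not an isometry; this identity is the
substitute used throughout. -/
lemma isOrthogonalSplitting_finAddEquivProd :
    IsOrthogonalSplitting (EuclideanSpace.finAddEquivProd (𝕜 := ℝ) (n := d) (m := k)) := by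
  intro x
  rw [EuclideanSpace.norm_sq_eq, EuclideanSpace.norm_sq_eq, EuclideanSpace.norm_sq_eq,
    Fin.sum_univ_add]
  simp only [finAddEquivProd_snd, finAddEquivProd_fst]

lemma IsSubmanifold.exists_straightening {M : Set (EuclideanSpace ℝ (Fin (d + k)))}
    (hM : IsSubmanifold d M) {p : EuclideanSpace ℝ (Fin (d + k))} (hp : p ∈ M) :
    ∃ Θ : OpenPartialHomeomorph (EuclideanSpace ℝ (Fin (d + k)))
        (EuclideanSpace ℝ (Fin d) × EuclideanSpace ℝ (Fin k)),
      p ∈ Θ.source ∧ ContDiffOn ℝ ∞ Θ Θ.source ∧ ContDiffOn ℝ ∞ Θ.symm Θ.target ∧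
        ∀ x ∈ Θ.source, x ∈ M ↔ (Θ x).2 = 0 := by
  obtain ⟨Φ, hpΦ, h1, h2, h3⟩ := hM p hp
  let j := EuclideanSpace.finAddEquivProd (𝕜 := ℝ) (n := d) (m := k)
  refine ⟨Φ.transHomeomorph j.toHomeomorph, hpΦ, j.contDiff.comp_contDiffOn h1,
    h2.comp j.symm.contDiff.contDiffOn fun x hx => hx, fun x hx => ?_⟩
  rw [h3 x hx]
  change _ ↔ (j (Φ x)).2 = 0
  constructor
  · intro h
    ext i
    rw [finAddEquivProd_snd]
    exact h _ (by simp)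
  · intro h i hi
    obtain ⟨i', rfl⟩ : ∃ i', i = Fin.natAdd d i' := ⟨⟨i - d, by omega⟩, by ext; simp; omega⟩
    rw [← finAddEquivProd_snd, h]
    rfl

/-- The normal bundle of radius `κ` over `M` is mapped injectively to the tube of radius `κ`, by
nearest-point projection. -/
structure IsTubular {E : Type*} [NormedAddCommGroup E] [InnerProductSpace ℝ E] (M : Set E)
    (κ : ℝ) : Prop where
  infDist_add : ∀ u ∈ M, ∀ z ∈ (Submodule.span ℝ (tangentConeAt ℝ M u))ᗮ, ‖z‖ < κ →
    Metric.infDist (u + z) M = ‖z‖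
  foot_unique : ∀ u ∈ M, ∀ z ∈ (Submodule.span ℝ (tangentConeAt ℝ M u))ᗮ, ‖z‖ < κ →
    ∀ v ∈ M, dist (u + z) v = ‖z‖ → v = u
  exists_foot : ∀ y, Metric.infDist y M < κ → ∃ u ∈ M,
    y - u ∈ (Submodule.span ℝ (tangentConeAt ℝ M u))ᗮ ∧ ‖y - u‖ = Metric.infDist y M

/-- No point of `M` lies in the open ball of radius `‖z‖` about `u + z`; squaring this gives a
one-sided quadratic bound on how `M` leaves its tangent space. It is the source of the curvature
bound. -/
lemma IsTubular.inner_le {E : Type*} [NormedAddCommGroup E] [InnerProductSpace ℝ E] {M : Set E}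
    {κ : ℝ} (h : IsTubular M κ) {u v z : E} (hu : u ∈ M) (hv : v ∈ M)
    (hz : z ∈ (Submodule.span ℝ (tangentConeAt ℝ M u))ᗮ) (hzκ : ‖z‖ < κ) :
    2 * inner ℝ z (v - u) ≤ ‖v - u‖ ^ 2 := by
  have h1 : ‖z‖ ≤ dist (u + z) v := by
    rw [← h.infDist_add u hu z hz hzκ]; exact Metric.infDist_le_dist_of_mem hv
  have h2 : u + z - v = z - (v - u) := by abel
  rw [dist_eq_norm, h2] at h1
  have h3 := pow_le_pow_left₀ (norm_nonneg _) h1 2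
  rw [norm_sub_sq_real] at h3
  linarith

/-- Both `u` and `v` realize the distance from the common point to `M`. This yields injectivity of
the tube map and disjointness of the fibers. -/
lemma IsTubular.eq_of_add_eq {E : Type*} [NormedAddCommGroup E] [InnerProductSpace ℝ E] {M : Set E}
    {κ : ℝ} (h : IsTubular M κ) {u v z w : E} (hu : u ∈ M) (hv : v ∈ M)
    (hz : z ∈ (Submodule.span ℝ (tangentConeAt ℝ M u))ᗮ) (hzκ : ‖z‖ < κ)
    (hw : w ∈ (Submodule.span ℝ (tangentConeAt ℝ M v))ᗮ) (hwκ : ‖w‖ < κ)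
    (he : u + z = v + w) : u = v := by
  refine (h.foot_unique u hu z hz hzκ v hv ?_).symm
  rw [← h.infDist_add u hu z hz hzκ, he, h.infDist_add v hv w hw hwκ, dist_eq_norm,
    add_sub_cancel_left]

/-- The reach is a supremum, so only radii below it are known to be admissible; the strict
inequality on `infDist` leaves room for one. -/
lemma existsUnique_of_le_reach {D : ℕ} {M : Set (EuclideanSpace ℝ (Fin D))} (hne : M.Nonempty)
    {κ : ℝ} (hr : ENNReal.ofReal κ ≤ reach M) (x : EuclideanSpace ℝ (Fin D))
    (hx : Metric.infDist x M < κ) : ∃! y, y ∈ M ∧ dist x y = Metric.infDist x M := by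
  obtain ⟨t, hxt, htκ⟩ := exists_between hx
  have ht0 : 0 ≤ t := Metric.infDist_nonneg.trans hxt.le
  have h1 : ENNReal.ofReal t < reach M :=
    ((ENNReal.ofReal_lt_ofReal_iff (ht0.trans_lt htκ)).2 htκ).trans_le hr
  simp only [reach, lt_iSup_iff] at h1
  obtain ⟨r, hr', htr⟩ := h1
  refine hr' x ?_
  rw [Metric.mem_thickening_iff_infDist_lt hne]
  rw [← ENNReal.ofReal_coe_nnreal] at htr
  exact hxt.trans (ENNReal.ofReal_lt_ofReal_iff'.1 htr).1

/-- Short normal segments minimize by smoothness, and unique nearest points allow prolonging them up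
to length `κ`. Feet exist by compactness and are orthogonal by the first-order condition. -/
theorem isTubular_of_le_reach {M : Set (EuclideanSpace ℝ (Fin (d + k)))} (hne : M.Nonempty)
    (hM : IsCompact M) (hs : IsSubmanifold d M) {κ : ℝ} (hr : ENNReal.ofReal κ ≤ reach M) :
    IsTubular M κ := by
  have hU := existsUnique_of_le_reach hne hr
  have hadd : ∀ u ∈ M, ∀ z ∈ (Submodule.span ℝ (tangentConeAt ℝ M u))ᗮ, ‖z‖ < κ →
      Metric.infDist (u + z) M = ‖z‖ := by
    intro u hu z hz hzκ
    obtain ⟨Θ, hp, h1, h2, h3⟩ := hs.exists_straightening hu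
    obtain ⟨δ, hδ, h⟩ := exists_infDist_normal h1 h2 h3 hp hu hz
    exact infDist_add_of_small hM hU hu hδ h hzκ
  refine ⟨hadd, fun u hu z hz hzκ v hv hd => ?_, fun y hy => ?_⟩
  · have h := hadd u hu z hz hzκ
    exact (hU (u + z) (by rwa [h])).unique ⟨hv, by rw [h, hd]⟩
      ⟨hu, by rw [h, dist_eq_norm, add_sub_cancel_left]⟩
  · obtain ⟨u, hu, h⟩ := hM.exists_infDist_eq_dist hne y
    obtain ⟨Θ, hp, h1, h2, h3⟩ := hs.exists_straightening hu
    obtain ⟨N⟩ := exists_normalChart h1 h2 h3 hp hu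
    exact ⟨u, hu, N.sub_mem_normal isOrthogonalSplitting_finAddEquivProd h.symm,
      by rw [h, dist_eq_norm]⟩

end Euclidean

end

/-! ### Determinants and bilinear forms -/

section

section LinearAlgebra

variable {A C : Type*} [NormedAddCommGroup A] [InnerProductSpace ℝ A]
  [NormedAddCommGroup C] [InnerProductSpace ℝ C]

/-- The shear `(ξ, ω) ↦ (ξ, ω + S ξ)`. -/
def shear (S : A →ₗ[ℝ] C) : A × C →ₗ[ℝ] A × C :=
  LinearMap.prod (LinearMap.fst ℝ A C) (LinearMap.snd ℝ A C + S.comp (LinearMap.fst ℝ A C))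

lemma shear_apply (S : A →ₗ[ℝ] C) (x : A × C) : shear S x = (x.1, x.2 + S x.1) := rfl

/-- The operator norm is at most the Hilbert–Schmidt norm. -/
lemma norm_apply_le_of_sum_sq_le {ι : Type*} [Fintype ι] (e : OrthonormalBasis ι ℝ A)
    (B : A →ₗ[ℝ] A) {q : ℝ} (hq : 0 ≤ q)
    (h : ∑ x : ι × ι, (inner ℝ (B (e x.1)) (e x.2)) ^ 2 ≤ q ^ 2) (ξ : A) : ‖B ξ‖ ≤ q * ‖ξ‖ := by
  refine le_of_sq_le_sq ?_ (by positivity)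
  rw [mul_pow, ← e.sum_sq_inner_right (B ξ), ← e.sum_sq_inner_right ξ]
  have h1 : ∀ i, (inner ℝ (e i) (B ξ)) ^ 2 ≤
      (∑ j, inner ℝ (B (e j)) (e i) ^ 2) * ∑ j, inner ℝ (e j) ξ ^ 2 := by
    intro i
    have h2 : inner ℝ (e i) (B ξ) = ∑ j, inner ℝ (B (e j)) (e i) * inner ℝ (e j) ξ := by
      conv_lhs => rw [← e.sum_repr' ξ]
      rw [map_sum, inner_sum]
      refine Finset.sum_congr rfl fun j _ => ?_
      rw [map_smul, inner_smul_right, real_inner_comm (B (e j)), mul_comm]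
    rw [h2]
    exact Finset.sum_mul_sq_le_sq_mul_sq _ _ _
  calc _ ≤ ∑ i, (∑ j, inner ℝ (B (e j)) (e i) ^ 2) * ∑ j, inner ℝ (e j) ξ ^ 2 :=
        Finset.sum_le_sum fun i _ => h1 i
    _ = (∑ x : ι × ι, (inner ℝ (B (e x.1)) (e x.2)) ^ 2) * ∑ j, inner ℝ (e j) ξ ^ 2 := by
        rw [← Finset.sum_mul, Fintype.sum_prod_type_right]
    _ ≤ _ := by gcongr

/-- A symmetric bilinear form is bounded by its values on the diagonal. -/
lemma abs_le_of_symm_of_diag {b : A → A → ℝ} {q : ℝ}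
    (hadd : ∀ x y z, b (x + y) z = b x z + b y z) (hsmul : ∀ (r : ℝ) x z, b (r • x) z = r * b x z)
    (hsymm : ∀ x y, b x y = b y x) (hdiag : ∀ x, |b x x| ≤ q * ‖x‖ ^ 2) (x y : A) :
    |b x y| ≤ q * (‖x‖ * ‖y‖) := by
  have hadd' : ∀ x y z, b z (x + y) = b z x + b z y := fun x y z => by
    rw [hsymm, hadd, hsymm x, hsymm y]
  have hsmul' : ∀ (r : ℝ) x z, b z (r • x) = r * b z x := fun r x z => by
    rw [hsymm, hsmul, hsymm x]
  -- Polarization on unit vectors: subtract the diagonal bounds at `x + y` and `x - y`, and use the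
  -- parallelogram law.
  have unit : ∀ x y : A, ‖x‖ = 1 → ‖y‖ = 1 → |b x y| ≤ q := by
    intro x y hx hy
    have h1 := hdiag (x + y)
    have h2 := hdiag (x + (-1 : ℝ) • y)
    have h3 := parallelogram_law_with_norm ℝ x y
    have h4 : x + (-1 : ℝ) • y = x - y := by rw [neg_one_smul, sub_eq_add_neg]
    have e1 : b (x + y) (x + y) = b x x + 2 * b x y + b y y := by
      rw [hadd, hadd', hadd', hsymm y x]; ring
    have e2 : b (x + (-1 : ℝ) • y) (x + (-1 : ℝ) • y) = b x x - 2 * b x y + b y y := by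
      simp only [hadd, hadd', hsmul, hsmul']; rw [hsymm y x]; ring
    rw [e1] at h1
    rw [e2, h4] at h2
    rw [hx, hy] at h3
    have h5 : q * ‖x + y‖ ^ 2 + q * ‖x - y‖ ^ 2 = 4 * q := by
      have : ‖x + y‖ ^ 2 + ‖x - y‖ ^ 2 = 4 := by nlinarith
      rw [← mul_add, this]; ring
    rw [abs_le] at h1 h2 ⊢
    constructor <;> linarith
  have hz : ∀ z, b 0 z = 0 := fun z => by simpa using hsmul 0 0 z
  rcases eq_or_ne x 0 with rfl | hx
  · simp [hz]
  rcases eq_or_ne y 0 with rfl | hy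
  · simp [hsymm x, hz]
  have hxp := norm_pos_iff.2 hx
  have hyp := norm_pos_iff.2 hy
  have h := unit (‖x‖⁻¹ • x) (‖y‖⁻¹ • y) (norm_smul_inv_norm hx) (norm_smul_inv_norm hy)
  rw [hsmul, hsmul', abs_mul, abs_mul, abs_of_pos (inv_pos.2 hxp), abs_of_pos (inv_pos.2 hyp),
    ← mul_assoc, ← mul_inv, inv_mul_le_iff₀ (by positivity)] at h
  linarith

/-- Scaling the second factor by two conjugates the shear by `S` to the shear by `2 S`, which is its
square. The determinant then equals its own square, and it is nonzero because the shear by `-S` is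
an inverse. -/
lemma det_shear (S : A →ₗ[ℝ] C) : LinearMap.det (shear S) = 1 := by
  have hadd : ∀ S' S'' : A →ₗ[ℝ] C, shear S' ∘ₗ shear S'' = shear (S' + S'') := by
    intro S' S''
    ext x <;> simp [shear_apply, add_comm]
  have h0 : shear (0 : A →ₗ[ℝ] C) = LinearMap.id := by ext x <;> simp [shear_apply]
  have hne : LinearMap.det (shear S) ≠ 0 := by
    intro h
    have := congrArg LinearMap.det (hadd S (-S))
    rw [LinearMap.det_comp, h, zero_mul, add_neg_cancel, h0, LinearMap.det_id] at this
    exact zero_ne_one this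
  let e : (A × C) ≃ₗ[ℝ] (A × C) :=
    (LinearEquiv.refl ℝ A).prodCongr (LinearEquiv.smulOfNeZero ℝ C (2 : ℝ) two_ne_zero)
  have hconj : (e : A × C →ₗ[ℝ] A × C) ∘ₗ shear S ∘ₗ (e.symm : A × C →ₗ[ℝ] A × C) =
      shear (S + S) := by
    refine LinearMap.ext fun x => ?_
    obtain ⟨y, rfl⟩ := e.surjective x
    simp only [LinearMap.comp_apply, LinearEquiv.coe_coe, LinearEquiv.symm_apply_apply]
    simp only [e, shear_apply, LinearEquiv.prodCongr_apply, LinearEquiv.refl_apply,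
      LinearEquiv.smulOfNeZero_apply, LinearMap.add_apply, smul_add, two_smul]
  have h1 := LinearMap.det_conj (shear S) e
  rw [hconj, ← hadd, LinearMap.det_comp] at h1
  exact mul_right_cancel₀ hne (by rw [h1, one_mul])

variable [FiniteDimensional ℝ A]

/-- The determinant is the volume ratio of the image of the unit ball, which lies in the ball of
radius `m`. -/
lemma abs_det_le (B : A →ₗ[ℝ] A) {m : ℝ} (hm : 0 ≤ m) (hB : ∀ ξ, ‖B ξ‖ ≤ m * ‖ξ‖) :
    |LinearMap.det B| ≤ m ^ Module.finrank ℝ A := by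
  borelize A
  have h := Measure.addHaar_image_linearMap (volume : Measure A) B (Metric.closedBall 0 1)
  have h2 : B '' Metric.closedBall 0 1 ⊆ Metric.closedBall 0 m := by
    rintro _ ⟨x, hx, rfl⟩
    rw [mem_closedBall_zero_iff] at hx ⊢
    exact (hB x).trans (mul_le_of_le_one_right hm hx)
  have h3 := measure_mono (μ := volume) h2
  rw [h, Measure.addHaar_closedBall' _ _ hm, ENNReal.mul_le_mul_iff_left
    (Metric.measure_closedBall_pos _ _ one_pos).ne' measure_closedBall_lt_top.ne] at h3
  exact (ENNReal.ofReal_le_ofReal_iff (by positivity)).1 h3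

/-- The upper bound applied to the inverse. -/
lemma le_abs_det (B : A →ₗ[ℝ] A) {m : ℝ} (hm : 0 < m) (hB : ∀ ξ, m * ‖ξ‖ ≤ ‖B ξ‖) :
    m ^ Module.finrank ℝ A ≤ |LinearMap.det B| := by
  have hinj : Function.Injective B := by
    rw [injective_iff_map_eq_zero]
    intro x hx
    have := hB x
    rw [hx, norm_zero] at this
    exact norm_eq_zero.1 (le_antisymm (nonpos_of_mul_nonpos_right this hm) (norm_nonneg _))
  let e := LinearEquiv.ofInjectiveEndo B hinj
  have he : (e : A →ₗ[ℝ] A) = B := by ext; rfl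
  have h1 := abs_det_le (e.symm : A →ₗ[ℝ] A) (inv_nonneg.2 hm.le) (fun ξ => by
    obtain ⟨η, rfl⟩ := e.surjective ξ
    have h := hB η
    simp only [LinearEquiv.coe_coe, LinearEquiv.symm_apply_apply]
    rw [inv_mul_eq_div, le_div_iff₀ hm, mul_comm]
    exact h)
  have h2 : |LinearMap.det B| * |LinearMap.det (e.symm : A →ₗ[ℝ] A)| = 1 := by
    rw [← abs_mul, ← he, LinearEquiv.det_mul_det_symm, abs_one]
  have h3 : 0 ≤ |LinearMap.det B| := abs_nonneg _
  rw [inv_pow] at h1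
  have h4 : (1 : ℝ) ≤ |LinearMap.det B| * (m ^ Module.finrank ℝ A)⁻¹ := by
    rw [← h2]; gcongr
  have hp : 0 < m ^ Module.finrank ℝ A := by positivity
  rwa [← div_eq_mul_inv, le_div_iff₀ hp, one_mul] at h4

end LinearAlgebra

/-! ### Linear forms on high-dimensional balls -/

section Moment

variable {C : Type*} [NormedAddCommGroup C] [InnerProductSpace ℝ C] [FiniteDimensional ℝ C]
  [MeasurableSpace C] [BorelSpace C]

lemma integrableOn_ball_of_continuous {f : C → ℝ} (hf : Continuous f) (r : ℝ) :
    IntegrableOn f (Metric.ball 0 r) :=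
  (hf.continuousOn.integrableOn_compact (isCompact_closedBall 0 r)).mono_set
    Metric.ball_subset_closedBall

/-- Second moments of linear functionals on a Euclidean ball. -/
lemma finrank_mul_setIntegral_inner_sq_le (a : C) (r : ℝ) :
    Module.finrank ℝ C * ∫ c in Metric.ball (0 : C) r, inner ℝ a c ^ 2 ≤
      ‖a‖ ^ 2 * r ^ 2 * volume.real (Metric.ball (0 : C) r) := by
  -- Vectors of equal norm are exchanged by a reflection, which preserves the ball. So all vectors
  -- `‖a‖ • e i` have the second moment of `a`, and summing over the basis gives that of `‖c‖`.
  have hrot : ∀ a b : C, ‖a‖ = ‖b‖ → ∫ c in Metric.ball (0 : C) r, inner ℝ a c ^ 2 =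
      ∫ c in Metric.ball (0 : C) r, inner ℝ b c ^ 2 := by
    intro a b hab
    let R := ((ℝ ∙ (a - b))ᗮ).reflection
    have hR : R a = b := Submodule.reflection_sub hab
    have h := R.measurePreserving.setIntegral_preimage_emb
      R.toHomeomorph.measurableEmbedding (fun c => inner ℝ b c ^ 2) (Metric.ball 0 r)
    have hpre : R ⁻¹' Metric.ball 0 r = Metric.ball 0 r := by
      ext x; simp
    rw [hpre] at h
    rw [← h]
    refine integral_congr_ae (Filter.Eventually.of_forall fun c => ?_)
    simp only
    rw [← hR, R.inner_map_map]
  let e := stdOrthonormalBasis ℝ C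
  have hsum : ∑ i, ∫ c in Metric.ball (0 : C) r, inner ℝ (‖a‖ • e i) c ^ 2 =
      ∫ c in Metric.ball (0 : C) r, ‖a‖ ^ 2 * ‖c‖ ^ 2 := by
    rw [← integral_finsetSum _ fun i _ =>
      integrableOn_ball_of_continuous (by fun_prop) r]
    refine integral_congr_ae (Filter.Eventually.of_forall fun c => ?_)
    simp only [inner_smul_left, conj_trivial, mul_pow]
    rw [← Finset.mul_sum, e.sum_sq_inner_right]
  have h1 : ∀ i ∈ Finset.univ, ∫ c in Metric.ball (0 : C) r, inner ℝ (‖a‖ • e i) c ^ 2 =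
      ∫ c in Metric.ball (0 : C) r, inner ℝ a c ^ 2 := fun i _ =>
    hrot _ _ (by rw [norm_smul, norm_norm, e.norm_eq_one, mul_one])
  rw [Finset.sum_congr rfl h1, Finset.sum_const, Finset.card_univ, Fintype.card_fin,
    nsmul_eq_mul] at hsum
  rw [hsum]
  calc _ ≤ ∫ c in Metric.ball (0 : C) r, ‖a‖ ^ 2 * r ^ 2 := by
        refine setIntegral_mono_on (integrableOn_ball_of_continuous (by fun_prop) r)
          (integrableOn_ball_of_continuous (by fun_prop) r) measurableSet_ball fun c hc => ?_
        rw [mem_ball_zero_iff] at hc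
        gcongr
    _ = _ := by rw [setIntegral_const, smul_eq_mul, mul_comm]

/-- The proportion of a ball on which finitely many linear forms are small. -/
def smallProportion (m : ℕ) : ℝ := 1 / 2 * (1 / (2 * m + 1)) ^ (8 * m)

lemma smallProportion_pos (m : ℕ) : 0 < smallProportion m := by
  unfold smallProportion; positivity

/-- In a ball on which `m` linear forms are bounded by one, their sum of squares is at most `1 / 4`
on a proportion of the ball which depends on `m` only: in high dimension by Chebyshev's inequality,
in low dimension since a smaller concentric ball has this property. -/
lemma smallProportion_mul_volume_ball_le {ι : Type*} [Fintype ι] (f : ι → C →ₗ[ℝ] ℝ) {r : ℝ}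
    (hr : 0 < r) (hf : ∀ i c, |f i c| ≤ ‖c‖ / r) :
    smallProportion (Fintype.card ι) * volume.real (Metric.ball (0 : C) r) ≤
      volume.real {c : C | ‖c‖ < r ∧ ∑ i, f i c ^ 2 ≤ 1 / 4} := by
  set m := Fintype.card ι with hm
  set k := Module.finrank ℝ C with hk
  have hcont : ∀ i, Continuous (f i) := fun i => (f i).continuous_of_finiteDimensional
  have hg : Continuous fun c => ∑ i, f i c ^ 2 := by fun_prop
  set V := volume.real (Metric.ball (0 : C) r) with hV
  have hV0 : 0 ≤ V := measureReal_nonneg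
  have hfin : volume {c : C | ‖c‖ < r ∧ ∑ i, f i c ^ 2 ≤ 1 / 4} ≠ ⊤ :=
    ((measure_mono (t := Metric.ball (0 : C) r) (fun c hc => by simpa using hc.1)).trans_lt
      measure_ball_lt_top).ne
  have hpow1 : ((1 : ℝ) / (2 * m + 1)) ^ (8 * m) ≤ 1 :=
    pow_le_one₀ (by positivity) (by rw [div_le_one (by positivity)]; linarith [m.cast_nonneg (α := ℝ)])
  -- When `8 * m ≤ k` the mean of the sum of squares is at most `m / k ≤ 1 / 8`, so it exceeds `1 /
  -- 4` on at most half of the ball.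
  rcases le_or_gt (8 * m) k with hmk | hmk
  · have hI : k * ∫ c in Metric.ball (0 : C) r, ∑ i, f i c ^ 2 ≤ m * V := by
      rw [integral_finsetSum _ fun i _ => integrableOn_ball_of_continuous (by fun_prop) r,
        Finset.mul_sum]
      have hone : ∀ i ∈ Finset.univ, k * ∫ c in Metric.ball (0 : C) r, f i c ^ 2 ≤ V := by
        intro i _
        let a := (InnerProductSpace.toDual ℝ C).symm (LinearMap.toContinuousLinearMap (f i))
        have ha : ∀ c, inner ℝ a c = f i c := fun c =>
          InnerProductSpace.toDual_symm_apply (y := LinearMap.toContinuousLinearMap (f i))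
        have hnorm : ‖a‖ ≤ 1 / r := by
          rw [LinearIsometryEquiv.norm_map]
          refine ContinuousLinearMap.opNorm_le_bound _ (by positivity) fun c => ?_
          rw [one_div_mul_eq_div]
          exact hf i c
        have h := finrank_mul_setIntegral_inner_sq_le a r
        simp only [ha] at h
        refine h.trans ?_
        calc ‖a‖ ^ 2 * r ^ 2 * V ≤ (1 / r) ^ 2 * r ^ 2 * V := by gcongr
          _ = V := by field_simp
      calc _ ≤ ∑ i : ι, V := Finset.sum_le_sum hone
        _ = m * V := by rw [Finset.sum_const, Finset.card_univ, nsmul_eq_mul]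
    set G := {c : C | ‖c‖ < r ∧ ∑ i, f i c ^ 2 ≤ 1 / 4} with hG
    set Bd := {c : C | ‖c‖ < r ∧ 1 / 4 < ∑ i, f i c ^ 2} with hBd
    have hBm : MeasurableSet Bd :=
      (measurableSet_lt measurable_norm measurable_const).inter
        (measurableSet_lt measurable_const hg.measurable)
    have hunion : Metric.ball (0 : C) r ⊆ G ∪ Bd := fun c hc => by
      rw [mem_ball_zero_iff] at hc
      exact (le_or_gt (∑ i, f i c ^ 2) (1 / 4)).imp (fun h => ⟨hc, h⟩) fun h => ⟨hc, h⟩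
    have hBsub : Bd ⊆ Metric.ball (0 : C) r := fun c hc => by simpa using hc.1
    have hBfin : volume Bd ≠ ⊤ := ((measure_mono hBsub).trans_lt measure_ball_lt_top).ne
    have hVle : V ≤ volume.real G + volume.real Bd :=
      (measureReal_mono hunion (measure_union_ne_top hfin hBfin)).trans (measureReal_union_le _ _)
    have hmark : 1 / 4 * volume.real Bd ≤ ∫ c in Metric.ball (0 : C) r, ∑ i, f i c ^ 2 := by
      calc 1 / 4 * volume.real Bd = ∫ c in Bd, (1 / 4 : ℝ) := by
            rw [setIntegral_const, smul_eq_mul, mul_comm]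
        _ ≤ ∫ c in Bd, ∑ i, f i c ^ 2 :=
            setIntegral_mono_on (integrableOn_const hBfin)
              ((integrableOn_ball_of_continuous hg r).mono_set hBsub) hBm fun c hc => hc.2.le
        _ ≤ _ := setIntegral_mono_set (integrableOn_ball_of_continuous hg r)
              (Filter.Eventually.of_forall fun c => by positivity)
              (LE.le.eventuallyLE hBsub)
    have hb : volume.real Bd ≤ 1 / 2 * V := by
      rcases Nat.eq_zero_or_pos m with h0 | h0
      · have : IsEmpty ι := Fintype.card_eq_zero_iff.1 (hm ▸ h0)
        have : Bd = ∅ := by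
          ext c
          simp only [hBd, Finset.univ_eq_empty, Finset.sum_empty, mem_ofPred_eq, mem_empty_iff_false,
            iff_false, not_and]
          intro _; norm_num
        rw [this]; simp; exact hV0
      · have hkm : (8 * m : ℝ) ≤ k := by exact_mod_cast hmk
        have hm0 : (0 : ℝ) < m := by exact_mod_cast h0
        have h1 : (8 * m : ℝ) * (1 / 4 * volume.real Bd) ≤ m * V :=
          le_trans (mul_le_mul hkm hmark (by positivity) (by positivity)) hI
        have h2 : m * (2 * volume.real Bd) ≤ m * V := by linarith
        have := le_of_mul_le_mul_left h2 hm0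
        linarith
    calc smallProportion m * V ≤ 1 / 2 * 1 * V := by
          unfold smallProportion; gcongr
      _ ≤ volume.real G := by linarith
  -- When `k < 8 * m`, shrink the radius by `2 * m + 1`: the sum of squares is at most `m / (2 * m +
  -- 1) ^ 2 ≤ 1 / 4`, and the lost volume factor has exponent below `8 * m`.
  · have hsub : Metric.ball (0 : C) (1 / (2 * m + 1) * r) ⊆
        {c : C | ‖c‖ < r ∧ ∑ i, f i c ^ 2 ≤ 1 / 4} := by
      intro c hc
      rw [mem_ball_zero_iff] at hc
      have hle : (1 : ℝ) / (2 * m + 1) ≤ 1 := by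
        rw [div_le_one (by positivity)]; linarith [m.cast_nonneg (α := ℝ)]
      refine ⟨hc.trans_le (mul_le_of_le_one_left hr.le hle), ?_⟩
      have hone : ∀ i ∈ Finset.univ, f i c ^ 2 ≤ (1 / (2 * m + 1) : ℝ) ^ 2 := by
        intro i _
        rw [← sq_abs]
        refine pow_le_pow_left₀ (abs_nonneg _) ((hf i c).trans ?_) 2
        rw [div_le_iff₀ hr]
        exact hc.le
      refine (Finset.sum_le_sum hone).trans ?_
      rw [Finset.sum_const, Finset.card_univ, nsmul_eq_mul, div_pow, one_pow, mul_one_div,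
        div_le_div_iff₀ (by positivity) (by norm_num)]
      nlinarith [m.cast_nonneg (α := ℝ)]
    refine le_trans ?_ (measureReal_mono hsub hfin)
    have hscale : volume.real (Metric.ball (0 : C) (1 / (2 * m + 1) * r)) =
        (1 / (2 * m + 1)) ^ k * V := by
      rw [measureReal_def, Measure.addHaar_ball_mul_of_pos _ _ (by positivity), ENNReal.toReal_mul,
        ENNReal.toReal_ofReal (by positivity)]
      rfl
    rw [hscale]
    gcongr
    unfold smallProportion
    have : ((1 : ℝ) / (2 * m + 1)) ^ (8 * m) ≤ (1 / (2 * m + 1)) ^ k :=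
      pow_le_pow_of_le_one (by positivity)
        (by rw [div_le_one (by positivity)]; linarith [m.cast_nonneg (α := ℝ)]) hmk.le
    have h0 : (0 : ℝ) ≤ (1 / (2 * m + 1)) ^ (8 * m) := by positivity
    linarith

end Moment

end

/-! ### Curvature bound and Jacobian of the tube map -/

section

namespace NormalChart

variable {A C E : Type*} [NormedAddCommGroup A] [InnerProductSpace ℝ A]
  [NormedAddCommGroup C] [InnerProductSpace ℝ C] [NormedAddCommGroup E] [InnerProductSpace ℝ E]
  {M : Set E} {p : E} (N : NormalChart A C M p)

/-- The parametrization of the tube around `M` given by a normal chart. -/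
def tube (q : A × C) : E := N.ψ q.1 + N.n q.1 q.2

/-- The differential of `NormalChart.tube`. -/
def dtube (q : A × C) : A × C →L[ℝ] E :=
  (fderiv ℝ N.ψ q.1).comp (ContinuousLinearMap.fst ℝ A C) +
    ((N.n q.1).comp (ContinuousLinearMap.snd ℝ A C) +
      ((fderiv ℝ N.n q.1).flip q.2).comp (ContinuousLinearMap.fst ℝ A C))

lemma hasFDerivAt_ψ {a : A} (ha : a ∈ N.U) : HasFDerivAt N.ψ (fderiv ℝ N.ψ a) a :=
  ((N.contDiffOn_ψ.contDiffAt (N.isOpen_U.mem_nhds ha)).differentiableAt (by simp)).hasFDerivAt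

lemma hasFDerivAt_n {a : A} (ha : a ∈ N.U) : HasFDerivAt N.n (fderiv ℝ N.n a) a :=
  ((N.contDiffOn_n.contDiffAt (N.isOpen_U.mem_nhds ha)).differentiableAt (by simp)).hasFDerivAt

lemma hasFDerivAt_tube {q : A × C} (hq : q.1 ∈ N.U) : HasFDerivAt N.tube (N.dtube q) q := by
  have h1 : HasFDerivAt (fun q : A × C => N.ψ q.1) _ q :=
    (N.hasFDerivAt_ψ hq).comp q hasFDerivAt_fst
  have h2 : HasFDerivAt (fun q : A × C => N.n q.1) _ q :=
    (N.hasFDerivAt_n hq).comp q hasFDerivAt_fst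
  refine (h1.add (h2.clm_apply hasFDerivAt_snd)).congr_fderiv ?_
  rfl

lemma continuousOn_dtube : ContinuousOn N.dtube (N.U ×ˢ univ) := by
  have h1 : ContinuousOn (fun q : A × C => fderiv ℝ N.ψ q.1) (N.U ×ˢ univ) :=
    (N.contDiffOn_ψ.continuousOn_fderiv_of_isOpen N.isOpen_U le_rfl).comp continuousOn_fst
      fun q hq => hq.1
  have h2 : ContinuousOn (fun q : A × C => fderiv ℝ N.n q.1) (N.U ×ˢ univ) :=
    (N.contDiffOn_n.continuousOn_fderiv_of_isOpen N.isOpen_U le_rfl).comp continuousOn_fst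
      fun q hq => hq.1
  have h3 : ContinuousOn (fun q : A × C => N.n q.1) (N.U ×ˢ univ) :=
    N.contDiffOn_n.continuousOn.comp continuousOn_fst fun q hq => hq.1
  have h4 : ContinuousOn (fun q : A × C => (fderiv ℝ N.n q.1).flip) (N.U ×ˢ univ) :=
    (ContinuousLinearMap.flipₗᵢ ℝ A C E).continuous.comp_continuousOn h2
  have h5 : ContinuousOn (fun q : A × C => (fderiv ℝ N.n q.1).flip q.2) (N.U ×ˢ univ) :=
    h4.clm_apply continuousOn_snd
  exact (h1.clm_comp continuousOn_const).add
    ((h3.clm_comp continuousOn_const).add (h5.clm_comp continuousOn_const))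

open Filter Topology in
/-- The second fundamental form of a set of reach at least `κ` is bounded by `1 / κ`. -/
lemma abs_inner_fderiv_n_le {κ : ℝ} (hκ : 0 < κ) (hT : IsTubular M κ) (ξ : A) (c : C) :
    |inner ℝ (fderiv ℝ N.n 0 ξ c) (fderiv ℝ N.ψ 0 ξ)| ≤ ‖c‖ / κ * ‖ξ‖ ^ 2 := by
  have hp0 := N.ψ_mem 0 N.zero_mem
  -- Add `IsTubular.inner_le` for the pair `ψ (t • ξ)`, `ψ 0` in both orders, divide by `t ^ 2` and
  -- let `t → 0`. Replacing `c` by `-c` then bounds the absolute value.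
  have main : ∀ c : C, ‖c‖ < κ →
      -‖ξ‖ ^ 2 ≤ inner ℝ (fderiv ℝ N.n 0 ξ c) (fderiv ℝ N.ψ 0 ξ) := by
    intro c hc
    have hline : Tendsto (fun t : ℝ => t • ξ) (𝓝[≠] 0) (𝓝 0) := by
      have : Tendsto (fun t : ℝ => t • ξ) (𝓝 0) (𝓝 ((0 : ℝ) • ξ)) :=
        Continuous.tendsto (by fun_prop) 0
      rw [zero_smul] at this
      exact this.mono_left nhdsWithin_le_nhds
    have hl : HasDerivAt (fun t : ℝ => t • ξ) ξ 0 := by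
      simpa using (hasDerivAt_id (0 : ℝ)).smul_const ξ
    have hψ : HasDerivAt (fun t : ℝ => N.ψ (t • ξ)) (fderiv ℝ N.ψ 0 ξ) 0 := by
      have h0 := N.hasFDerivAt_ψ N.zero_mem
      rw [← zero_smul ℝ ξ] at h0
      have := h0.comp_hasDerivAt (0 : ℝ) hl
      rwa [zero_smul] at this
    have hn : HasDerivAt (fun t : ℝ => N.n (t • ξ) c) (fderiv ℝ N.n 0 ξ c) 0 := by
      have h0 := N.hasFDerivAt_n N.zero_mem
      rw [← zero_smul ℝ ξ] at h0
      have := h0.comp_hasDerivAt (0 : ℝ) hl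
      rw [zero_smul] at this
      simpa using this.clm_apply (hasDerivAt_const (0 : ℝ) c)
    have hs1 := hψ.tendsto_slope
    have hs2 := hn.tendsto_slope
    have hlim := hs2.inner (𝕜 := ℝ) hs1
    have hlim' := (hs1.norm.pow 2).neg
    rw [N.norm_fderiv_ψ] at hlim'
    refine le_of_tendsto_of_tendsto hlim' hlim ?_
    have hev1 : ∀ᶠ t : ℝ in 𝓝[≠] 0, t • ξ ∈ N.U := hline (N.isOpen_U.mem_nhds N.zero_mem)
    have hev2 : ∀ᶠ t : ℝ in 𝓝[≠] 0, ‖N.n (t • ξ) c‖ < κ := by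
      have h1 := (hn.continuousAt.norm).tendsto
      simp only [zero_smul, N.norm_n_zero] at h1
      exact (h1.mono_left nhdsWithin_le_nhds).eventually_lt_const hc
    filter_upwards [hev1, hev2, self_mem_nhdsWithin] with t ht1 ht2 ht0
    have hut := N.ψ_mem _ ht1
    have hz : N.n (t • ξ) c ∈ (Submodule.span ℝ (tangentConeAt ℝ M (N.ψ (t • ξ))))ᗮ := by
      rw [← N.range_n _ ht1]; exact ⟨c, rfl⟩
    have hw : N.n 0 c ∈ (Submodule.span ℝ (tangentConeAt ℝ M (N.ψ 0)))ᗮ := by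
      rw [← N.range_n _ N.zero_mem]; exact ⟨c, rfl⟩
    have e1 := hT.inner_le hut.1 hp0.1 hz ht2
    have e2 := hT.inner_le hp0.1 hut.1 hw (by rwa [N.norm_n_zero])
    rw [slope_def_module, slope_def_module]
    simp only [sub_zero, zero_smul]
    rw [norm_smul, inner_smul_left, inner_smul_right, conj_trivial, mul_pow, norm_inv,
      Real.norm_eq_abs, inv_pow, sq_abs, inner_sub_left]
    rw [norm_sub_rev, ← neg_sub (N.ψ (t • ξ)), inner_neg_right] at e1
    have e3 : -‖N.ψ (t • ξ) - N.ψ 0‖ ^ 2 ≤ inner ℝ (N.n (t • ξ) c) (N.ψ (t • ξ) - N.ψ 0) -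
        inner ℝ (N.n 0 c) (N.ψ (t • ξ) - N.ψ 0) := by linarith
    have e4 := mul_le_mul_of_nonneg_left e3 (show 0 ≤ (t ^ 2)⁻¹ by positivity)
    have e5 : t⁻¹ * t⁻¹ = (t ^ 2)⁻¹ := by rw [sq, mul_inv]
    rw [← mul_assoc, e5]
    linarith
  have habs : ∀ c : C, ‖c‖ < κ →
      |inner ℝ (fderiv ℝ N.n 0 ξ c) (fderiv ℝ N.ψ 0 ξ)| ≤ ‖ξ‖ ^ 2 := by
    intro c hc
    have h1 := main c hc
    have h2 := main (-c) (by rwa [norm_neg])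
    rw [map_neg, inner_neg_left] at h2
    rw [abs_le]
    constructor <;> linarith
  rcases eq_or_ne c 0 with rfl | hc
  · simp
  have hc0 := norm_pos_iff.2 hc
  set X := |inner ℝ (fderiv ℝ N.n 0 ξ c) (fderiv ℝ N.ψ 0 ξ)| with hX
  -- Linearity in `c` allows rescaling it to any norm `s < κ`; letting `s → κ` gives the sharp
  -- factor `1 / κ`.
  have hs : ∀ s, 0 < s → s < κ → s * X ≤ ‖c‖ * ‖ξ‖ ^ 2 := by
    intro s hs hsκ
    have h := habs ((s / ‖c‖) • c) (by
      rw [norm_smul, Real.norm_of_nonneg (by positivity), div_mul_cancel₀ _ hc0.ne']; exact hsκ)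
    rw [map_smul, inner_smul_left, conj_trivial, abs_mul, abs_of_pos (by positivity), ← hX,
      div_mul_eq_mul_div, div_le_iff₀ hc0] at h
    linarith
  have hκX : κ * X ≤ ‖c‖ * ‖ξ‖ ^ 2 := by
    have hlim : Tendsto (fun s : ℝ => s * X) (𝓝[<] κ) (𝓝 (κ * X)) :=
      (Continuous.tendsto (by fun_prop) κ).mono_left nhdsWithin_le_nhds
    refine le_of_tendsto hlim ?_
    filter_upwards [Ioo_mem_nhdsLT hκ] with s h using hs s h.1 h.2
  rw [div_mul_eq_mul_div, le_div_iff₀ hκ]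
  linarith

section FiniteDimensional

variable [FiniteDimensional ℝ A] [FiniteDimensional ℝ E]

/-- Minus the shape operator of `M` at `p` in the normal direction with coordinates `c`. -/
def shape (c : C) : A →L[ℝ] A :=
  (adjointL (fderiv ℝ N.ψ 0)).comp ((fderiv ℝ N.n 0).flip c)

lemma inner_shape (c : C) (ξ η : A) :
    inner ℝ (N.shape c ξ) η = inner ℝ (fderiv ℝ N.n 0 ξ c) (fderiv ℝ N.ψ 0 η) := by
  rw [shape, ContinuousLinearMap.comp_apply, inner_adjointL_left, ContinuousLinearMap.flip_apply]

/-- The reach bounds the second fundamental form on the diagonal only; its symmetry extends the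
bound by polarization. -/
lemma abs_inner_shape_le {κ : ℝ} (hκ : 0 < κ) (hT : IsTubular M κ) (c : C) (ξ η : A) :
    |inner ℝ (N.shape c ξ) η| ≤ ‖c‖ / κ * (‖ξ‖ * ‖η‖) := by
  refine abs_le_of_symm_of_diag (b := fun ξ η => inner ℝ (N.shape c ξ) η) (fun x y z => ?_)
    (fun r x z => ?_) (fun x y => ?_) (fun x => ?_) ξ η
  · simp only [map_add, inner_add_left]
  · simp only [map_smul, inner_smul_left, conj_trivial]
  · simp only [inner_shape, N.symm]
  · simp only [inner_shape]
    exact N.abs_inner_fderiv_n_le hκ hT x c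

lemma norm_shape_le {κ : ℝ} (hκ : 0 < κ) (hT : IsTubular M κ) (c : C) (ξ : A) :
    ‖N.shape c ξ‖ ≤ ‖c‖ / κ * ‖ξ‖ := by
  have h := N.abs_inner_shape_le hκ hT c ξ (N.shape c ξ)
  rw [real_inner_self_eq_norm_sq, abs_of_nonneg (sq_nonneg _)] at h
  rcases (norm_nonneg (N.shape c ξ)).eq_or_lt with h0 | h0
  · rw [← h0]; positivity
  · refine le_of_mul_le_mul_right ?_ h0
    linarith

variable [FiniteDimensional ℝ C]

/-- The Jacobian of the tube parametrization over the centre of a normal chart. -/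
lemma abs_det_dtube {j : E ≃L[ℝ] A × C} (hj : IsOrthogonalSplitting j) (c : C) :
    |((N.dtube (0, c)).comp (j : E →L[ℝ] A × C)).det| =
      |LinearMap.det (LinearMap.id + (N.shape c : A →ₗ[ℝ] A))| := by
  obtain ⟨O, hO⟩ := N.exists_frame hj
  -- The derivative of the normal frame splits into a tangential part, `shape`, and a normal part
  -- `S`. The latter enters only through a shear, so it does not affect the determinant.
  let S : A →ₗ[ℝ] C := ((adjointL (N.n 0)).comp ((fderiv ℝ N.n 0).flip c) : A →L[ℝ] C)
  let Q : A × C →ₗ[ℝ] A × C :=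
    (LinearMap.prodMap (LinearMap.id + (N.shape c : A →ₗ[ℝ] A)) LinearMap.id) ∘ₗ shear S
  have hQ : LinearMap.det Q = LinearMap.det (LinearMap.id + (N.shape c : A →ₗ[ℝ] A)) := by
    rw [LinearMap.det_comp, det_shear, mul_one, LinearMap.det_prodMap, LinearMap.det_id, mul_one]
  let ψ' : A →ₗᵢ[ℝ] E := ⟨(fderiv ℝ N.ψ 0 : A →ₗ[ℝ] E), N.norm_fderiv_ψ⟩
  let n' : C →ₗᵢ[ℝ] E := ⟨(N.n 0 : C →ₗ[ℝ] E), N.norm_n_zero⟩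
  have hψ' : ∀ x y, inner ℝ (fderiv ℝ N.ψ 0 x) (fderiv ℝ N.ψ 0 y) = inner ℝ x y :=
    ψ'.inner_map_map
  have hn' : ∀ x y, inner ℝ (N.n 0 x) (N.n 0 y) = inner ℝ x y := n'.inner_map_map
  have hdecomp : ∀ v : E, fderiv ℝ N.ψ 0 (adjointL (fderiv ℝ N.ψ 0) v) +
      N.n 0 (adjointL (N.n 0) v) = v := by
    intro v
    obtain ⟨x, rfl⟩ := O.surjective v
    rw [hO]
    congr 2
    · refine ext_inner_right ℝ fun η => ?_
      rw [inner_adjointL_left, inner_add_left, hψ', real_inner_comm (fderiv ℝ N.ψ 0 η),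
        N.inner_fderiv_n, add_zero]
    · refine ext_inner_right ℝ fun η => ?_
      rw [inner_adjointL_left, inner_add_left, hn', N.inner_fderiv_n, zero_add]
  have hfac : ((N.dtube (0, c)).comp (j : E →L[ℝ] A × C) : E →ₗ[ℝ] E) =
      (O.toLinearEquiv : E →ₗ[ℝ] E) ∘ₗ ((j.toLinearEquiv.symm : A × C →ₗ[ℝ] E) ∘ₗ Q ∘ₗ
        (j.toLinearEquiv.symm.symm : E →ₗ[ℝ] A × C)) := by
    refine LinearMap.ext fun x => ?_
    change N.dtube (0, c) (j x) = O (j.symm (Q (j x)))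
    rw [hO, ContinuousLinearEquiv.apply_symm_apply]
    set y := j x
    change fderiv ℝ N.ψ 0 y.1 + (N.n 0 y.2 + fderiv ℝ N.n 0 y.1 c) =
      fderiv ℝ N.ψ 0 (y.1 + adjointL (fderiv ℝ N.ψ 0) (fderiv ℝ N.n 0 y.1 c)) +
        N.n 0 (y.2 + adjointL (N.n 0) (fderiv ℝ N.n 0 y.1 c))
    rw [map_add, map_add]
    conv_lhs => rw [← hdecomp (fderiv ℝ N.n 0 y.1 c)]
    abel
  have hOdet : |LinearMap.det (O.toLinearEquiv : E →ₗ[ℝ] E)| = 1 := by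
    apply le_antisymm
    · simpa using abs_det_le (O.toLinearEquiv : E →ₗ[ℝ] E) zero_le_one
        (fun ξ => by rw [one_mul]; exact (O.norm_map ξ).le)
    · simpa using le_abs_det (O.toLinearEquiv : E →ₗ[ℝ] E) zero_lt_one
        (fun ξ => by rw [one_mul]; exact (O.norm_map ξ).ge)
  rw [ContinuousLinearMap.det, hfac, LinearMap.det_comp, LinearMap.det_conj, hQ, abs_mul, hOdet,
    one_mul]

end FiniteDimensional

end NormalChart

end

/-! ### Uniform control near the centre of a chart -/

section

namespace NormalChart

variable {A C E : Type*} [NormedAddCommGroup A] [InnerProductSpace ℝ A]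
  [NormedAddCommGroup C] [InnerProductSpace ℝ C] [NormedAddCommGroup E] [InnerProductSpace ℝ E]
  {M : Set E} {p : E} (N : NormalChart A C M p)

-- Strict differentiability at a point where the differential is isometric.
open Filter Topology in
lemma eventually_bilipschitz {K : ℝ} (hK : 1 < K) :
    ∀ᶠ x : A × A in 𝓝 (0, 0), ‖N.ψ x.1 - N.ψ x.2‖ ≤ K * ‖x.1 - x.2‖ ∧
      ‖x.1 - x.2‖ ≤ K * ‖N.ψ x.1 - N.ψ x.2‖ := by
  have hd : HasStrictFDerivAt N.ψ (fderiv ℝ N.ψ 0) 0 :=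
    (N.contDiffOn_ψ.contDiffAt (N.isOpen_U.mem_nhds N.zero_mem)).hasStrictFDerivAt (by simp)
  have hK0 : 0 < K := by linarith
  -- An error of `K - 1` is allowed by the upper estimate and one of `1 - K⁻¹` by the lower one.
  have he : 0 < min (K - 1) (1 - K⁻¹) :=
    lt_min (by linarith) (by linarith [inv_lt_one_of_one_lt₀ hK])
  filter_upwards [hd.isLittleO.def he] with x hx
  set v := N.ψ x.1 - N.ψ x.2
  set w := x.1 - x.2
  have h0 : ‖fderiv ℝ N.ψ 0 w‖ = ‖w‖ := N.norm_fderiv_ψ w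
  have h1 : ‖v‖ ≤ ‖fderiv ℝ N.ψ 0 w‖ + ‖v - fderiv ℝ N.ψ 0 w‖ := norm_le_norm_add_norm_sub' _ _
  have h2 : ‖fderiv ℝ N.ψ 0 w‖ ≤ ‖v‖ + ‖v - fderiv ℝ N.ψ 0 w‖ := norm_le_norm_add_norm_sub _ _
  have h3 : min (K - 1) (1 - K⁻¹) * ‖w‖ ≤ (K - 1) * ‖w‖ := by gcongr; exact min_le_left _ _
  have h4 : min (K - 1) (1 - K⁻¹) * ‖w‖ ≤ (1 - K⁻¹) * ‖w‖ := by gcongr; exact min_le_right _ _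
  refine ⟨by linarith, ?_⟩
  have h5 : K⁻¹ * ‖w‖ ≤ ‖v‖ := by linarith
  rwa [inv_mul_le_iff₀ hK0] at h5

open Filter Topology in
lemma eventually_norm_n {K : ℝ} (hK : 1 < K) :
    ∀ᶠ a in 𝓝 (0 : A), ∀ c, ‖N.n a c‖ ≤ K * ‖c‖ ∧ ‖c‖ ≤ K * ‖N.n a c‖ := by
  have hK0 : 0 < K := by linarith
  have he : 0 < min (K - 1) (1 - K⁻¹) :=
    lt_min (by linarith) (by linarith [inv_lt_one_of_one_lt₀ hK])
  have hc : ContinuousAt N.n 0 := (N.hasFDerivAt_n N.zero_mem).continuousAt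
  filter_upwards [Metric.continuousAt_iff'.1 hc _ he] with a ha c
  rw [dist_eq_norm] at ha
  have h := (N.n a - N.n 0).le_of_opNorm_le ha.le c
  rw [sub_apply] at h
  have h1 : ‖N.n a c‖ ≤ ‖N.n 0 c‖ + ‖N.n a c - N.n 0 c‖ := norm_le_norm_add_norm_sub' _ _
  have h2 : ‖N.n 0 c‖ ≤ ‖N.n a c‖ + ‖N.n a c - N.n 0 c‖ := norm_le_norm_add_norm_sub _ _
  rw [N.norm_n_zero] at h1 h2
  have h3 : min (K - 1) (1 - K⁻¹) * ‖c‖ ≤ (K - 1) * ‖c‖ := by gcongr; exact min_le_left _ _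
  have h4 : min (K - 1) (1 - K⁻¹) * ‖c‖ ≤ (1 - K⁻¹) * ‖c‖ := by gcongr; exact min_le_right _ _
  refine ⟨by linarith, ?_⟩
  have h5 : K⁻¹ * ‖c‖ ≤ ‖N.n a c‖ := by linarith
  rwa [inv_mul_le_iff₀ hK0] at h5

/-- The Jacobian of the tube parametrization in the coordinates `j`. -/
def jac (j : E ≃L[ℝ] A × C) (q : A × C) : ℝ := |((N.dtube q).comp (j : E →L[ℝ] A × C)).det|

-- The Jacobian is continuous, and compactness of the ball makes the neighbourhood of `0` uniform in
-- `c`.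
open Filter Topology in
lemma eventually_jac (j : E ≃L[ℝ] A × C) [FiniteDimensional ℝ C] (r : ℝ) {δ : ℝ} (hδ : 0 < δ) :
    ∀ᶠ a in 𝓝 (0 : A), ∀ c ∈ Metric.closedBall (0 : C) r,
      |N.jac j (a, c) - N.jac j (0, c)| < δ := by
  refine (isCompact_closedBall (0 : C) r).eventually_forall_of_forall_eventually fun c _ => ?_
  have hjac : ∀ q : A × C, q.1 ∈ N.U → ContinuousAt (N.jac j) q := by
    intro q hq
    have h1 : ContinuousAt N.dtube q := N.continuousOn_dtube.continuousAt
      ((N.isOpen_U.prod isOpen_univ).mem_nhds ⟨hq, mem_univ _⟩)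
    exact (ContinuousLinearMap.continuous_det.continuousAt.comp
      (h1.clm_comp continuousAt_const)).abs
  have h1 : ContinuousAt (fun q : A × C => N.jac j q) (0, c) := hjac _ N.zero_mem
  have h2 : ContinuousAt (fun q : A × C => N.jac j (0, q.2)) (0, c) :=
    ContinuousAt.comp (f := fun q : A × C => ((0 : A), q.2)) (hjac _ N.zero_mem)
      (Continuous.continuousAt (by fun_prop))
  exact (h1.sub h2).abs.eventually_lt continuousAt_const (by simpa using hδ)

variable [FiniteDimensional ℝ A] [FiniteDimensional ℝ E]

/-- The matrix entries of `NormalChart.shape`, as linear forms in the normal direction. -/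
def shapeEntry (x : Fin (Module.finrank ℝ A) × Fin (Module.finrank ℝ A)) : C →ₗ[ℝ] ℝ where
  toFun c := inner ℝ (N.shape c (stdOrthonormalBasis ℝ A x.1)) (stdOrthonormalBasis ℝ A x.2)
  map_add' c c' := by simp only [inner_shape, map_add, inner_add_left]
  map_smul' r c := by
    simp only [inner_shape, map_smul, inner_smul_left, conj_trivial, RingHom.id_apply, smul_eq_mul]

lemma abs_shapeEntry_le {κ : ℝ} (hκ : 0 < κ) (hT : IsTubular M κ)
    (x : Fin (Module.finrank ℝ A) × Fin (Module.finrank ℝ A)) (c : C) :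
    |N.shapeEntry x c| ≤ ‖c‖ / κ := by
  have h := N.abs_inner_shape_le hκ hT c (stdOrthonormalBasis ℝ A x.1) (stdOrthonormalBasis ℝ A x.2)
  rwa [(stdOrthonormalBasis ℝ A).norm_eq_one, (stdOrthonormalBasis ℝ A).norm_eq_one, mul_one,
    mul_one] at h

variable [FiniteDimensional ℝ C]

lemma jac_zero_le_of_shape {j : E ≃L[ℝ] A × C} (hj : IsOrthogonalSplitting j) {c : C} {q : ℝ}
    (hq : 0 ≤ q) (hq1 : q < 1) (h : ∀ ξ, ‖N.shape c ξ‖ ≤ q * ‖ξ‖) :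
    (1 - q) ^ Module.finrank ℝ A ≤ N.jac j (0, c) ∧
      N.jac j (0, c) ≤ (1 + q) ^ Module.finrank ℝ A := by
  rw [jac, N.abs_det_dtube hj]
  constructor
  · refine le_abs_det _ (by linarith) fun ξ => ?_
    have h1 : ‖ξ‖ ≤ ‖ξ + N.shape c ξ‖ + ‖N.shape c ξ‖ := by
      simpa using norm_sub_le (ξ + N.shape c ξ) (N.shape c ξ)
    have := h ξ
    change _ ≤ ‖ξ + N.shape c ξ‖
    linarith
  · refine abs_det_le _ (by linarith) fun ξ => ?_
    change ‖ξ + N.shape c ξ‖ ≤ _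
    linarith [h ξ, norm_add_le ξ (N.shape c ξ)]

/-- A small coordinate ball on which a normal chart is nearly isometric and the Jacobian of the
tube parametrization is controlled. -/
theorem exists_nice_ball {j : E ≃L[ℝ] A × C} (hj : IsOrthogonalSplitting j) {κ r K : ℝ}
    (hT : IsTubular M κ) (hr : 0 < r) (hrκ : r < κ) (hK : 1 < K) :
    ∃ ε > 0, Metric.ball 0 ε ⊆ N.U ∧
      (∀ a ∈ Metric.ball (0 : A) ε, ∀ b ∈ Metric.ball (0 : A) ε,
        ‖N.ψ a - N.ψ b‖ ≤ K * ‖a - b‖ ∧ ‖a - b‖ ≤ K * ‖N.ψ a - N.ψ b‖) ∧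
      ∀ a ∈ Metric.ball (0 : A) ε, ∀ c, (‖N.n a c‖ ≤ K * ‖c‖ ∧ ‖c‖ ≤ K * ‖N.n a c‖) ∧
        (‖c‖ ≤ r → 1 / 2 * (1 - r / κ) ^ Module.finrank ℝ A ≤ N.jac j (a, c) ∧
          N.jac j (a, c) ≤ 2 * 2 ^ Module.finrank ℝ A ∧
          (∑ x, N.shapeEntry x c ^ 2 ≤ 1 / 4 →
            1 / 2 * (1 / 2) ^ Module.finrank ℝ A ≤ N.jac j (a, c))) := by
  have hκ : 0 < κ := hr.trans hrκ
  have hrκ1 : r / κ < 1 := (div_lt_one hκ).2 hrκ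
  set m := Module.finrank ℝ A
  -- Half of each lower bound valid over the centre: moving to nearby base points then costs at most
  -- a factor two.
  set δ := min (1 / 2 * (1 - r / κ) ^ m) (1 / 2 * (1 / 2) ^ m) with hδ
  have h1r : 0 < 1 - r / κ := by linarith
  have hδ0 : 0 < δ := by positivity
  have hev := (Filter.Eventually.prod_nhds (N.isOpen_U.mem_nhds N.zero_mem)
    (N.isOpen_U.mem_nhds N.zero_mem)).and (N.eventually_bilipschitz hK)
  rw [nhds_prod_eq, Filter.eventually_prod_self_iff'] at hev
  obtain ⟨t, ht, hbl⟩ := hev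
  obtain ⟨ε, hε, hball⟩ := Metric.mem_nhds_iff.1 (Filter.inter_mem ht
    ((N.eventually_norm_n hK).and (N.eventually_jac j r hδ0)))
  refine ⟨ε, hε, fun a ha => (hbl a (hball ha).1 a (hball ha).1).1.1,
    fun a ha b hb => (hbl a (hball ha).1 b (hball hb).1).2, fun a ha c => ⟨(hball ha).2.1 c, ?_⟩⟩
  intro hc
  have h3 := abs_lt.1 ((hball ha).2.2 c (mem_closedBall_zero_iff.2 hc))
  have hcr : ‖c‖ / κ ≤ r / κ := by gcongr
  have h4 := N.jac_zero_le_of_shape hj (c := c) (q := r / κ) (by positivity) hrκ1 fun ξ =>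
    (N.norm_shape_le hκ hT c ξ).trans (by gcongr)
  have hδ1 : δ ≤ 1 / 2 * (1 - r / κ) ^ m := min_le_left _ _
  have hδ2 : δ ≤ 1 / 2 * (1 / 2) ^ m := min_le_right _ _
  have hup : (1 + r / κ) ^ m ≤ 2 ^ m := pow_le_pow_left₀ (by positivity) (by linarith) m
  have hhalf : (1 / 2 : ℝ) ^ m ≤ 1 := pow_le_one₀ (by norm_num) (by norm_num)
  have htwo : (1 : ℝ) ≤ 2 ^ m := one_le_pow₀ (by norm_num)
  refine ⟨by linarith, by linarith, fun hs => ?_⟩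
  -- Sum of squares at most `1 / 4` means Hilbert–Schmidt norm, hence operator norm, at most `1 /
  -- 2`. This estimate does not see how close `r` is to `κ`.
  have h5 := N.jac_zero_le_of_shape hj (c := c) (q := 1 / 2) (by norm_num) (by norm_num)
    (norm_apply_le_of_sum_sq_le (stdOrthonormalBasis ℝ A) (N.shape c : A →ₗ[ℝ] A) (by norm_num)
      (by norm_num at hs ⊢; exact hs))
  have e : (1 - 1 / 2 : ℝ) = 1 / 2 := by norm_num
  rw [e] at h5
  linarith

end NormalChart

end

/-! ### Hausdorff measure and uniform laws on fibers -/

section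

section HausdorffLinear

variable {C E : Type*} [NormedAddCommGroup C] [InnerProductSpace ℝ C] [FiniteDimensional ℝ C]
  [MeasurableSpace C] [BorelSpace C] [NormedAddCommGroup E] [InnerProductSpace ℝ E]
  [MeasurableSpace E] [BorelSpace E]

/-- An injective affine map multiplies Lebesgue measure by a constant. -/
lemma exists_hausdorffMeasure_affine_image (T : C →L[ℝ] E) (hT : Function.Injective T) (u : E) :
    ∃ J : ℝ≥0∞, J ≠ 0 ∧ J ≠ ⊤ ∧ ∀ G : Set C,
      μH[Module.finrank ℝ C] ((fun c => u + T c) '' G) = J * volume G := by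
  -- After the change of variables `L` the map is an isometry, which preserves Hausdorff measure; on
  -- the model space that measure is a Haar measure, so proportional to `volume`.
  obtain ⟨L, hL⟩ := exists_equiv_norm_eq T hT
  set s := (μH[Module.finrank ℝ C] : Measure C).addHaarScalarFactor volume
  have hs : (μH[Module.finrank ℝ C] : Measure C) = s • volume :=
    Measure.isAddLeftInvariant_eq_smul _ _
  have hs0 : s ≠ 0 := (Measure.addHaarScalarFactor_pos_of_isAddHaarMeasure _ _).ne'
  have hdet : LinearMap.det ((L.symm : C →L[ℝ] C) : C →ₗ[ℝ] C) ≠ 0 :=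
    (LinearEquiv.isUnit_det' L.symm.toLinearEquiv).ne_zero
  refine ⟨s * ENNReal.ofReal |LinearMap.det ((L.symm : C →L[ℝ] C) : C →ₗ[ℝ] C)|, ?_, ?_,
    fun G => ?_⟩
  · exact mul_ne_zero (by simpa using hs0) (by simpa using hdet)
  · exact ENNReal.mul_ne_top ENNReal.coe_ne_top ENNReal.ofReal_ne_top
  · have hiso : Isometry fun c => u + T (L c) := by
      refine Isometry.of_dist_eq fun c c' => ?_
      rw [dist_add_left, dist_eq_norm, ← map_sub, ← map_sub, hL, dist_eq_norm]
    have himg : (fun c => u + T c) '' G = (fun c => u + T (L c)) '' (L.symm '' G) := by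
      rw [image_image]; simp
    rw [himg, hiso.hausdorffMeasure_image (Or.inl (Nat.cast_nonneg _)), hs, Measure.smul_apply]
    change s • volume (((L.symm : C →L[ℝ] C) : C →ₗ[ℝ] C) '' G) = _
    rw [Measure.addHaar_image_linearMap, ENNReal.smul_def, smul_eq_mul, mul_assoc]

end HausdorffLinear

lemma measurableSet_inter_preimage_of_continuousOn {X Y : Type*} [TopologicalSpace X]
    [MeasurableSpace X] [OpensMeasurableSpace X] [TopologicalSpace Y] [MeasurableSpace Y]
    [BorelSpace Y] {f : X → Y} {s : Set X} {t : Set Y} (hs : MeasurableSet s)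
    (hf : ContinuousOn f s) (ht : MeasurableSet t) : MeasurableSet (s ∩ f ⁻¹' t) := by
  have h := hs.subtype_image ((continuousOn_iff_continuous_domRestrict.1 hf).measurable ht)
  convert h using 1
  ext x
  constructor
  · rintro ⟨hx, hy⟩
    exact ⟨⟨x, hx⟩, hy, rfl⟩
  · rintro ⟨⟨x, hx⟩, hy, rfl⟩
    exact ⟨hx, hy⟩

/-- The space `ℝⁿ`. -/
abbrev Eu (n : ℕ) : Type := EuclideanSpace ℝ (Fin n)

instance isAddHaarMeasure_hausdorffMeasure_eu (n : ℕ) :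
    (μH[(n : ℝ)] : Measure (Eu n)).IsAddHaarMeasure := by
  simpa using MeasureTheory.isAddHaarMeasure_hausdorffMeasure (E := Eu n)

variable {d k : ℕ}

/-- The coordinates `ℝᵈ⁺ᵏ ≃ ℝᵈ × ℝᵏ`. -/
abbrev splitting (d k : ℕ) : Eu (d + k) ≃L[ℝ] Eu d × Eu k :=
  EuclideanSpace.finAddEquivProd (𝕜 := ℝ) (n := d) (m := k)

/-- The ratio of Lebesgue measure on `ℝᵈ⁺ᵏ` to the product of Hausdorff measure on `ℝᵈ` and
Lebesgue measure on `ℝᵏ`. -/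
def splitConst (d k : ℕ) : ℝ≥0 :=
  ((volume : Measure (Eu (d + k))).map (splitting d k)).addHaarScalarFactor
    ((μH[(d : ℝ)] : Measure (Eu d)).prod (volume : Measure (Eu k)))

lemma splitConst_ne_zero : splitConst d k ≠ 0 := by
  have : ((volume : Measure (Eu (d + k))).map (splitting d k)).IsAddHaarMeasure :=
    ContinuousLinearEquiv.isAddHaarMeasure_map _ _
  exact (Measure.addHaarScalarFactor_pos_of_isAddHaarMeasure _ _).ne'

lemma volume_preimage_splitting {X : Set (Eu d × Eu k)} (hX : MeasurableSet X) :
    volume (splitting d k ⁻¹' X) =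
      splitConst d k * ((μH[(d : ℝ)] : Measure (Eu d)).prod (volume : Measure (Eu k))) X := by
  have : ((volume : Measure (Eu (d + k))).map (splitting d k)).IsAddHaarMeasure :=
    ContinuousLinearEquiv.isAddHaarMeasure_map _ _
  rw [← Measure.map_apply (splitting d k).continuous.measurable hX,
    Measure.isAddLeftInvariant_eq_smul ((volume : Measure (Eu (d + k))).map (splitting d k))
      ((μH[(d : ℝ)] : Measure (Eu d)).prod (volume : Measure (Eu k))), Measure.smul_apply]
  rfl

namespace NormalChart

variable {M : Set (Eu (d + k))} {p : Eu (d + k)} (N : NormalChart (Eu d) (Eu k) M p)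

lemma mem_fiber_iff {σ : ℝ} {a : Eu d} (ha : a ∈ N.U) {y : Eu (d + k)} :
    y ∈ fiber σ M (N.ψ a) ↔ ∃ c, ‖N.n a c‖ < σ ∧ N.tube (a, c) = y := by
  have hr : ∀ z, z ∈ (tangentSpace M (N.ψ a))ᗮ ↔ ∃ c, N.n a c = z := fun z => by
    rw [tangentSpace, ← N.range_n a ha]; rfl
  change (y - N.ψ a ∈ (tangentSpace M (N.ψ a))ᗮ ∧ dist y (N.ψ a) < σ) ↔ _
  rw [hr, dist_eq_norm]
  constructor
  · rintro ⟨⟨c, hc⟩, h⟩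
    exact ⟨c, by rwa [hc], by rw [tube, hc, add_sub_cancel]⟩
  · rintro ⟨c, hc, rfl⟩
    simp only [tube, add_sub_cancel_left]
    exact ⟨⟨c, rfl⟩, hc⟩

lemma measurableSet_fiber {D : ℕ} (σ : ℝ) (M : Set (Eu D)) (u : Eu D) :
    MeasurableSet (fiber σ M u) := by
  refine MeasurableSet.inter ?_ Metric.isOpen_ball.measurableSet
  have : IsClosed ((tangentSpace M u)ᗮ : Set (Eu D)) := Submodule.closed_of_finiteDimensional _
  exact (this.preimage (f := fun y => y - u) (by fun_prop)).measurableSet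

/-- The uniform distribution on a fiber in a normal chart. -/
lemma uniformOn_fiber (σ : ℝ) {a : Eu d} (ha : a ∈ N.U) (S : Set (Eu (d + k))) :
    uniformOn (((d + k : ℕ) : ℝ) - d) (fiber σ M (N.ψ a)) S =
      volume {c | ‖N.n a c‖ < σ ∧ N.tube (a, c) ∈ S} / volume {c | ‖N.n a c‖ < σ} := by
  obtain ⟨J, hJ0, hJt, hJ⟩ := exists_hausdorffMeasure_affine_image (N.n a) (N.injective_n a ha)
    (N.ψ a)
  have hk : ((d + k : ℕ) : ℝ) - d = Module.finrank ℝ (Eu k) := by simp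
  have h1 : fiber σ M (N.ψ a) = (fun c => N.ψ a + N.n a c) '' {c | ‖N.n a c‖ < σ} := by
    ext y; rw [N.mem_fiber_iff ha]; rfl
  have h2 : fiber σ M (N.ψ a) ∩ S =
      (fun c => N.ψ a + N.n a c) '' {c | ‖N.n a c‖ < σ ∧ N.tube (a, c) ∈ S} := by
    ext y
    rw [mem_inter_iff, N.mem_fiber_iff ha]
    constructor
    · rintro ⟨⟨c, hc, rfl⟩, h⟩
      exact ⟨c, ⟨hc, h⟩, rfl⟩
    · rintro ⟨c, ⟨hc, h⟩, rfl⟩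
      exact ⟨⟨c, hc, rfl⟩, h⟩
  rw [uniformOn, ProbabilityTheory.cond_apply (measurableSet_fiber σ M _), h2, h1, hk, hJ, hJ,
    ← ENNReal.mul_div_mul_left _ _ hJ0 hJt, ENNReal.div_eq_inv_mul]

end NormalChart

end

/-! ### Change of variables in the tube -/

section

variable {d k : ℕ}

/-- The union of the fibers over a subset of `M`. -/
def tubeOver (σ : ℝ) (M P : Set (Eu (d + k))) : Set (Eu (d + k)) := ⋃ u ∈ P, fiber σ M u

namespace NormalChart

variable {M : Set (Eu (d + k))} {p : Eu (d + k)} (N : NormalChart (Eu d) (Eu k) M p)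

/-- The points of a normal chart over `B` of normal radius `σ` which are mapped to `S`. -/
def domain (σ : ℝ) (B : Set (Eu d)) (S : Set (Eu (d + k))) : Set (Eu d × Eu k) :=
  {q | q.1 ∈ B ∧ ‖N.n q.1 q.2‖ < σ ∧ N.tube q ∈ S}

lemma measurableSet_domain (σ : ℝ) {B : Set (Eu d)} (hB : MeasurableSet B) (hBU : B ⊆ N.U)
    {S : Set (Eu (d + k))} (hS : MeasurableSet S) : MeasurableSet (N.domain σ B S) := by
  have h1 : ContinuousOn (fun q : Eu d × Eu k => N.n q.1 q.2) (B ×ˢ univ) :=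
    ((N.contDiffOn_n.continuousOn.mono hBU).comp continuousOn_fst fun q hq => hq.1).clm_apply
      continuousOn_snd
  have h2 : ContinuousOn (fun q : Eu d × Eu k => N.ψ q.1) (B ×ˢ univ) :=
    (N.contDiffOn_ψ.continuousOn.mono hBU).comp continuousOn_fst fun q hq => hq.1
  have h3 : ContinuousOn (fun q : Eu d × Eu k => (N.n q.1 q.2, N.tube q)) (B ×ˢ univ) :=
    h1.prodMk (h2.add h1)
  have h := measurableSet_inter_preimage_of_continuousOn (hB.prod MeasurableSet.univ) h3
    ((Metric.isOpen_ball (x := (0 : Eu (d + k))) (ε := σ)).measurableSet.prod hS)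
  convert h using 1
  ext q
  simp [domain]

lemma tube_image_domain (σ : ℝ) {B : Set (Eu d)} (hBU : B ⊆ N.U) (S : Set (Eu (d + k))) :
    N.tube '' N.domain σ B S = S ∩ tubeOver σ M (N.ψ '' B) := by
  ext y
  simp only [tubeOver, biUnion_image, mem_inter_iff, mem_iUnion, exists_prop]
  constructor
  · rintro ⟨q, ⟨hq1, hq2, hq3⟩, rfl⟩
    exact ⟨hq3, q.1, hq1, (N.mem_fiber_iff (hBU hq1)).2 ⟨q.2, hq2, rfl⟩⟩
  · rintro ⟨hy, a, ha, hf⟩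
    obtain ⟨c, hc, rfl⟩ := (N.mem_fiber_iff (hBU ha)).1 hf
    exact ⟨(a, c), ⟨ha, hc, hy⟩, rfl⟩

lemma injOn_tube {κ σ : ℝ} (hσ : σ ≤ κ) (hT : IsTubular M κ) {B : Set (Eu d)} (hBU : B ⊆ N.U)
    (S : Set (Eu (d + k))) : InjOn N.tube (N.domain σ B S) := by
  rintro ⟨a, c⟩ ⟨ha, hc, -⟩ ⟨b, c'⟩ ⟨hb, hc', -⟩ h
  have hz : ∀ a ∈ N.U, ∀ c, N.n a c ∈ (Submodule.span ℝ (tangentConeAt ℝ M (N.ψ a)))ᗮ :=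
    fun a ha c => by rw [← N.range_n _ ha]; exact ⟨c, rfl⟩
  have h1 : N.ψ a = N.ψ b := hT.eq_of_add_eq (N.ψ_mem a (hBU ha)).1 (N.ψ_mem b (hBU hb)).1
    (hz a (hBU ha) c) (hc.trans_le hσ) (hz b (hBU hb) c') (hc'.trans_le hσ) h
  have h2 : a = b := by rw [← N.ρ_ψ a (hBU ha), h1, N.ρ_ψ b (hBU hb)]
  subst h2
  have h3 : N.n a c = N.n a c' := by simpa [tube] using h
  rw [N.injective_n a (hBU ha) h3]

/-- The change of variables formula concerns maps of a space to itself, so the tube map is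
precomposed with the splitting; `jac` is defined accordingly. -/
lemma volume_image_tube {κ σ : ℝ} (hσ : σ ≤ κ) (hT : IsTubular M κ) {B : Set (Eu d)}
    (hBU : B ⊆ N.U) {X : Set (Eu d × Eu k)} (hX : MeasurableSet X)
    (hXd : X ⊆ N.domain σ B univ) :
    volume (N.tube '' X) =
      ∫⁻ x in splitting d k ⁻¹' X, ENNReal.ofReal (N.jac (splitting d k) (splitting d k x)) := by
  set j := splitting d k
  have hder : ∀ x ∈ j ⁻¹' X, HasFDerivWithinAt (N.tube ∘ j)
      ((N.dtube (j x)).comp (j : Eu (d + k) →L[ℝ] Eu d × Eu k)) (j ⁻¹' X) x := fun x hx =>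
    ((N.hasFDerivAt_tube (hBU (hXd hx).1)).comp x j.hasFDerivAt).hasFDerivWithinAt
  have hinj : InjOn (N.tube ∘ j) (j ⁻¹' X) := by
    intro x hx y hy h
    exact j.injective (N.injOn_tube hσ hT hBU univ (hXd hx) (hXd hy) h)
  have h := lintegral_abs_det_fderiv_eq_addHaar_image volume
    (hX.preimage j.continuous.measurable) hder hinj
  rw [image_comp, image_preimage_eq _ j.surjective] at h
  exact h.symm

lemma le_volume_image_tube {κ σ : ℝ} (hσ : σ ≤ κ) (hT : IsTubular M κ) {B : Set (Eu d)}
    (hBU : B ⊆ N.U) {X : Set (Eu d × Eu k)} (hX : MeasurableSet X)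
    (hXd : X ⊆ N.domain σ B univ) {m : ℝ} (hm : ∀ q ∈ X, m ≤ N.jac (splitting d k) q) :
    ENNReal.ofReal m * (splitConst d k *
      ((μH[(d : ℝ)] : Measure (Eu d)).prod (volume : Measure (Eu k))) X) ≤
      volume (N.tube '' X) := by
  rw [N.volume_image_tube hσ hT hBU hX hXd, ← volume_preimage_splitting hX, ← setLIntegral_const]
  exact setLIntegral_mono' (hX.preimage (splitting d k).continuous.measurable) fun x hx =>
    ENNReal.ofReal_le_ofReal (hm _ hx)

lemma volume_image_tube_le {κ σ : ℝ} (hσ : σ ≤ κ) (hT : IsTubular M κ) {B : Set (Eu d)}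
    (hBU : B ⊆ N.U) {X : Set (Eu d × Eu k)} (hX : MeasurableSet X)
    (hXd : X ⊆ N.domain σ B univ) {m : ℝ} (hm : ∀ q ∈ X, N.jac (splitting d k) q ≤ m) :
    volume (N.tube '' X) ≤ ENNReal.ofReal m * (splitConst d k *
      ((μH[(d : ℝ)] : Measure (Eu d)).prod (volume : Measure (Eu k))) X) := by
  rw [N.volume_image_tube hσ hT hBU hX hXd, ← volume_preimage_splitting hX, ← setLIntegral_const]
  exact setLIntegral_mono' (hX.preimage (splitting d k).continuous.measurable) fun x hx =>
    ENNReal.ofReal_le_ofReal (hm _ hx)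

/-- Hausdorff measure on a piece of `M` is comparable to that of its coordinate domain. -/
lemma hausdorffMeasure_image_comparable {K : ℝ} (hK : 0 ≤ K) (hKd : K ^ d ≤ 2)
    {U₀ : Set (Eu d)} (hU : U₀ ⊆ N.U)
    (hψ : ∀ a ∈ U₀, ∀ b ∈ U₀, ‖N.ψ a - N.ψ b‖ ≤ K * ‖a - b‖ ∧ ‖a - b‖ ≤ K * ‖N.ψ a - N.ψ b‖)
    {X : Set (Eu d)} (hX : X ⊆ U₀) :
    μH[(d : ℝ)] (N.ψ '' X) ≤ 2 * μH[(d : ℝ)] X ∧ μH[(d : ℝ)] X ≤ 2 * μH[(d : ℝ)] (N.ψ '' X) := by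
  have hK2 : ((Real.toNNReal K : ℝ≥0∞)) ^ (d : ℝ) ≤ 2 := by
    rw [ENNReal.rpow_natCast, ← ENNReal.ofReal, ← ENNReal.ofReal_pow hK]
    exact (ENNReal.ofReal_le_ofReal hKd).trans (by simp)
  constructor
  · have hL : LipschitzOnWith (Real.toNNReal K) N.ψ X := by
      refine LipschitzOnWith.of_dist_le_mul fun a ha b hb => ?_
      rw [dist_eq_norm, dist_eq_norm, Real.coe_toNNReal _ hK]
      exact (hψ a (hX ha) b (hX hb)).1
    exact (hL.hausdorffMeasure_image_le (Nat.cast_nonneg d)).trans (by gcongr)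
  · have hL : LipschitzOnWith (Real.toNNReal K) N.ρ (N.ψ '' X) := by
      refine LipschitzOnWith.of_dist_le_mul ?_
      rintro _ ⟨a, ha, rfl⟩ _ ⟨b, hb, rfl⟩
      rw [dist_eq_norm, dist_eq_norm, Real.coe_toNNReal _ hK, N.ρ_ψ a (hU (hX ha)),
        N.ρ_ψ b (hU (hX hb))]
      exact (hψ a (hX ha) b (hX hb)).2
    have h := hL.hausdorffMeasure_image_le (Nat.cast_nonneg d)
    have himg : N.ρ '' (N.ψ '' X) = X := by
      rw [image_image]
      exact (image_congr fun a ha => N.ρ_ψ a (hU (hX ha))).trans (image_id' X)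
    rw [himg] at h
    exact h.trans (by gcongr)

end NormalChart

end

/-! ### The noisy law in coordinates -/

section

variable {d k : ℕ}

lemma volume_ball_mul_le {K σ : ℝ} (hK : 0 < K) (hKk : K ^ k ≤ 2) :
    volume (Metric.ball (0 : Eu k) (K * σ)) ≤ 2 * volume (Metric.ball (0 : Eu k) σ) := by
  rw [Measure.addHaar_ball_mul_of_pos _ _ hK, finrank_euclideanSpace_fin]
  gcongr
  exact (ENNReal.ofReal_le_ofReal hKk).trans (by simp)

namespace NormalChart

variable {M : Set (Eu (d + k))} {p : Eu (d + k)} (N : NormalChart (Eu d) (Eu k) M p)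

/-- The section lies between the balls of radii `K⁻¹ * σ` and `K * σ`, and `K ^ k ≤ 2` keeps the
loss independent of `k`. -/
lemma volume_section_comparable {K σ : ℝ} (hK : 0 < K) (hKk : K ^ k ≤ 2) {a : Eu d}
    (hn : ∀ c, ‖N.n a c‖ ≤ K * ‖c‖ ∧ ‖c‖ ≤ K * ‖N.n a c‖) :
    volume {c | ‖N.n a c‖ < σ} ≤ 2 * volume (Metric.ball (0 : Eu k) σ) ∧
      volume (Metric.ball (0 : Eu k) σ) ≤ 2 * volume {c | ‖N.n a c‖ < σ} := by
  constructor
  · refine (measure_mono fun c hc => ?_).trans (volume_ball_mul_le hK hKk)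
    rw [mem_ball_zero_iff]
    exact (hn c).2.trans_lt (by gcongr; exact hc)
  · have h := volume_ball_mul_le (σ := K⁻¹ * σ) hK hKk
    rw [mul_inv_cancel_left₀ hK.ne'] at h
    refine h.trans ?_
    gcongr
    intro c hc
    rw [mem_ball_zero_iff, lt_inv_mul_iff₀ hK] at hc
    exact (hn c).1.trans_lt hc

/-- The pushforward under `ρ` of Hausdorff measure on the piece is compared, set by set, with
Hausdorff measure on `B`. -/
lemma lintegral_comp_ρ_comparable {K : ℝ} (hK : 0 ≤ K) (hKd : K ^ d ≤ 2)
    {B : Set (Eu d)} (hU : B ⊆ N.U)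
    (hψ : ∀ a ∈ B, ∀ b ∈ B, ‖N.ψ a - N.ψ b‖ ≤ K * ‖a - b‖ ∧ ‖a - b‖ ≤ K * ‖N.ψ a - N.ψ b‖)
    (hP : MeasurableSet (N.ψ '' B)) {h : Eu d → ℝ≥0∞} (hh : Measurable h) :
    ∫⁻ u in N.ψ '' B, h (N.ρ u) ∂μH[(d : ℝ)] ≤ 2 * ∫⁻ a in B, h a ∂μH[(d : ℝ)] ∧
      ∫⁻ a in B, h a ∂μH[(d : ℝ)] ≤ 2 * ∫⁻ u in N.ψ '' B, h (N.ρ u) ∂μH[(d : ℝ)] := by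
  have hρ : AEMeasurable N.ρ ((μH[(d : ℝ)] : Measure (Eu (d + k))).restrict (N.ψ '' B)) := by
    refine (N.continuousOn_ρ.mono ?_).aemeasurable hP
    rintro _ ⟨a, ha, rfl⟩
    exact (N.ψ_mem a (hU ha)).2
  rw [← lintegral_map' hh.aemeasurable hρ]
  have hset : ∀ G : Set (Eu d), N.ρ ⁻¹' G ∩ N.ψ '' B = N.ψ '' (G ∩ B) := by
    intro G
    ext y
    constructor
    · rintro ⟨hy, a, ha, rfl⟩
      rw [mem_preimage, N.ρ_ψ a (hU ha)] at hy
      exact ⟨a, ⟨hy, ha⟩, rfl⟩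
    · rintro ⟨a, ⟨hG, ha⟩, rfl⟩
      exact ⟨by rwa [mem_preimage, N.ρ_ψ a (hU ha)], a, ha, rfl⟩
  have hcomp := fun G : Set (Eu d) =>
    N.hausdorffMeasure_image_comparable hK hKd hU hψ (X := G ∩ B) inter_subset_right
  constructor
  · rw [← smul_eq_mul, ← lintegral_smul_measure]
    refine lintegral_mono' (Measure.le_iff.2 fun G hG => ?_) le_rfl
    rw [Measure.map_apply_of_aemeasurable hρ hG, Measure.restrict_apply' hP, hset,
      Measure.smul_apply, Measure.restrict_apply hG, smul_eq_mul]
    exact (hcomp G).1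
  · rw [← smul_eq_mul, ← lintegral_smul_measure]
    refine lintegral_mono' (Measure.le_iff.2 fun G hG => ?_) le_rfl
    rw [Measure.smul_apply, Measure.map_apply_of_aemeasurable hρ hG, Measure.restrict_apply' hP,
      hset, Measure.restrict_apply hG, smul_eq_mul]
    exact (hcomp G).2

/-- The mass which the uniform distribution on the fiber at `ψ a` gives to `S`, as a function of the
coordinate `a ∈ B`. -/
def sectionRatio (σ : ℝ) (B : Set (Eu d)) (S : Set (Eu (d + k))) (a : Eu d) : ℝ≥0∞ :=
  volume (Prod.mk a ⁻¹' N.domain σ B S) / volume (Prod.mk a ⁻¹' N.domain σ B univ)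

lemma measurable_sectionRatio (σ : ℝ) {B : Set (Eu d)} (hB : MeasurableSet B) (hBU : B ⊆ N.U)
    {S : Set (Eu (d + k))} (hS : MeasurableSet S) : Measurable (N.sectionRatio σ B S) :=
  (measurable_measure_prodMk_left (N.measurableSet_domain σ hB hBU hS)).div
    (measurable_measure_prodMk_left (N.measurableSet_domain σ hB hBU MeasurableSet.univ))

lemma uniformOn_fiber_eq_sectionRatio (σ : ℝ) {B : Set (Eu d)} (hBU : B ⊆ N.U) {a : Eu d}
    (ha : a ∈ B) (S : Set (Eu (d + k))) :
    uniformOn (((d + k : ℕ) : ℝ) - d) (fiber σ M (N.ψ a)) S = N.sectionRatio σ B S a := by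
  rw [N.uniformOn_fiber σ (hBU ha), sectionRatio]
  simp [domain, ha, preimage]

/-- The fiber measures depend measurably on the base point. -/
lemma aemeasurable_uniformOn_fiber (σ : ℝ) {B : Set (Eu d)} (hB : MeasurableSet B)
    (hBU : B ⊆ N.U) (hP : MeasurableSet (N.ψ '' B)) (ν : Measure (Eu (d + k))) :
    AEMeasurable (fun u => uniformOn (((d + k : ℕ) : ℝ) - d) (fiber σ M u))
      (ν.restrict (N.ψ '' B)) := by
  refine aemeasurable_restrict_of_measurable_subtype hP
    (Measure.measurable_of_measurable_coe _ fun S hS => ?_)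
  have hρ : Measurable fun u : N.ψ '' B => N.ρ u := by
    have : ContinuousOn N.ρ (N.ψ '' B) := N.continuousOn_ρ.mono (by
      rintro _ ⟨a, ha, rfl⟩
      exact (N.ψ_mem a (hBU ha)).2)
    exact (continuousOn_iff_continuous_domRestrict.1 this).measurable
  convert (N.measurable_sectionRatio σ hB hBU hS).comp hρ using 1
  funext u
  obtain ⟨_, a, ha, rfl⟩ := u
  simp only [Function.comp_apply]
  rw [N.uniformOn_fiber_eq_sectionRatio σ hBU ha, N.ρ_ψ a (hBU ha)]

/-- The noisy law of a piece of `M` is comparable to product measure in coordinates. -/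
lemma lintegral_uniformOn_comparable {K σ : ℝ} (hK : 0 < K) (hσ : 0 < σ) (hKd : K ^ d ≤ 2)
    (hKk : K ^ k ≤ 2) {B : Set (Eu d)} (hB : MeasurableSet B) (hU : B ⊆ N.U)
    (hψ : ∀ a ∈ B, ∀ b ∈ B, ‖N.ψ a - N.ψ b‖ ≤ K * ‖a - b‖ ∧ ‖a - b‖ ≤ K * ‖N.ψ a - N.ψ b‖)
    (hn : ∀ a ∈ B, ∀ c, ‖N.n a c‖ ≤ K * ‖c‖ ∧ ‖c‖ ≤ K * ‖N.n a c‖)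
    (hP : MeasurableSet (N.ψ '' B)) {S : Set (Eu (d + k))} (hS : MeasurableSet S) :
    volume (Metric.ball (0 : Eu k) σ) * ∫⁻ u in N.ψ '' B,
        uniformOn (((d + k : ℕ) : ℝ) - d) (fiber σ M u) S ∂μH[(d : ℝ)] ≤
      4 * ((μH[(d : ℝ)] : Measure (Eu d)).prod (volume : Measure (Eu k))) (N.domain σ B S) ∧
    ((μH[(d : ℝ)] : Measure (Eu d)).prod (volume : Measure (Eu k))) (N.domain σ B S) ≤
      4 * (volume (Metric.ball (0 : Eu k) σ) * ∫⁻ u in N.ψ '' B,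
        uniformOn (((d + k : ℕ) : ℝ) - d) (fiber σ M u) S ∂μH[(d : ℝ)]) := by
  set β := volume (Metric.ball (0 : Eu k) σ) with hβ
  have hβ0 : β ≠ 0 := (Metric.measure_ball_pos _ _ hσ).ne'
  have hβt : β ≠ ⊤ := measure_ball_lt_top.ne
  have hint : ∫⁻ u in N.ψ '' B, uniformOn (((d + k : ℕ) : ℝ) - d) (fiber σ M u) S ∂μH[(d : ℝ)] =
      ∫⁻ u in N.ψ '' B, N.sectionRatio σ B S (N.ρ u) ∂μH[(d : ℝ)] := by
    refine setLIntegral_congr_fun hP ?_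
    rintro _ ⟨a, ha, rfl⟩
    simp only
    rw [N.uniformOn_fiber_eq_sectionRatio σ hU ha, N.ρ_ψ a (hU ha)]
  have hmeas := N.measurable_sectionRatio σ hB hU hS
  obtain ⟨h1, h2⟩ := N.lintegral_comp_ρ_comparable hK.le hKd hU hψ hP hmeas
  have hprod : ((μH[(d : ℝ)] : Measure (Eu d)).prod (volume : Measure (Eu k)))
      (N.domain σ B S) = ∫⁻ a in B, volume (Prod.mk a ⁻¹' N.domain σ B S) ∂μH[(d : ℝ)] := by
    rw [Measure.prod_apply (N.measurableSet_domain σ hB hU hS),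
      ← lintegral_indicator hB]
    refine lintegral_congr fun a => ?_
    by_cases ha : a ∈ B
    · rw [indicator_of_mem ha]
    · rw [indicator_of_notMem ha]
      have : Prod.mk a ⁻¹' N.domain σ B S = ∅ := by
        ext c; simp [domain, ha]
      rw [this, measure_empty]
  have hsec : ∀ a ∈ B, volume (Prod.mk a ⁻¹' N.domain σ B univ) = volume {c | ‖N.n a c‖ < σ} := by
    intro a ha
    simp [domain, ha, preimage]
  have h3 : β * ∫⁻ a in B, N.sectionRatio σ B S a ∂μH[(d : ℝ)] ≤
      2 * ∫⁻ a in B, volume (Prod.mk a ⁻¹' N.domain σ B S) ∂μH[(d : ℝ)] := by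
    rw [← lintegral_const_mul _ hmeas, ← lintegral_const_mul _
      (measurable_measure_prodMk_left (N.measurableSet_domain σ hB hU hS))]
    refine setLIntegral_mono' hB fun a ha => ?_
    have hc := (N.volume_section_comparable (σ := σ) hK hKk (hn a ha))
    rw [← hsec a ha] at hc
    have hy0 : volume (Prod.mk a ⁻¹' N.domain σ B univ) ≠ 0 := fun h0 => by
      rw [h0, mul_zero] at hc
      exact hβ0 (le_antisymm hc.2 zero_le)
    have hyt : volume (Prod.mk a ⁻¹' N.domain σ B univ) ≠ ⊤ :=
      ne_top_of_le_ne_top (ENNReal.mul_ne_top (by simp) hβt) hc.1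
    calc _ ≤ 2 * volume (Prod.mk a ⁻¹' N.domain σ B univ) * N.sectionRatio σ B S a := by
          gcongr; exact hc.2
      _ = _ := by
          rw [sectionRatio, mul_assoc, ENNReal.mul_div_cancel hy0 hyt]
  have h4 : ∫⁻ a in B, volume (Prod.mk a ⁻¹' N.domain σ B S) ∂μH[(d : ℝ)] ≤
      2 * (β * ∫⁻ a in B, N.sectionRatio σ B S a ∂μH[(d : ℝ)]) := by
    rw [← lintegral_const_mul _ hmeas, ← lintegral_const_mul _ (hmeas.const_mul _)]
    refine setLIntegral_mono' hB fun a ha => ?_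
    have hc := (N.volume_section_comparable (σ := σ) hK hKk (hn a ha))
    rw [← hsec a ha] at hc
    have hy0 : volume (Prod.mk a ⁻¹' N.domain σ B univ) ≠ 0 := fun h0 => by
      rw [h0, mul_zero] at hc
      exact hβ0 (le_antisymm hc.2 zero_le)
    have hyt : volume (Prod.mk a ⁻¹' N.domain σ B univ) ≠ ⊤ :=
      ne_top_of_le_ne_top (ENNReal.mul_ne_top (by simp) hβt) hc.1
    calc _ = volume (Prod.mk a ⁻¹' N.domain σ B univ) * N.sectionRatio σ B S a := by
          rw [sectionRatio, ENNReal.mul_div_cancel hy0 hyt]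
      _ ≤ _ := by rw [← mul_assoc]; gcongr; exact hc.1
  rw [hint, hprod]
  have e4 : (4 : ℝ≥0∞) = 2 * 2 := by norm_num
  constructor
  · calc _ ≤ β * (2 * ∫⁻ a in B, N.sectionRatio σ B S a ∂μH[(d : ℝ)]) := by gcongr
      _ = 2 * (β * ∫⁻ a in B, N.sectionRatio σ B S a ∂μH[(d : ℝ)]) := by ring
      _ ≤ 2 * (2 * _) := by gcongr
      _ = _ := by rw [e4, mul_assoc]
  · calc _ ≤ 2 * (β * ∫⁻ a in B, N.sectionRatio σ B S a ∂μH[(d : ℝ)]) := h4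
      _ ≤ 2 * (β * (2 * _)) := by gcongr
      _ = _ := by rw [e4]; ring

end NormalChart

end

/-! ### Local tube estimates -/

section

variable {d k : ℕ}

-- `K` may depend on the codimension, since only the bounds `K ^ d ≤ 2`, `K ^ k ≤ 2` and `K * σ ≤ r`
-- enter later.
open Filter Topology in
lemma exists_gt_one_pow_le_two (d k : ℕ) {σ r : ℝ} (hσ : σ < r) :
    ∃ K : ℝ, 1 < K ∧ K ^ d ≤ 2 ∧ K ^ k ≤ 2 ∧ K * σ ≤ r := by
  have h : ∀ n : ℕ, ∀ᶠ K : ℝ in 𝓝 1, K ^ n < 2 := fun n =>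
    ContinuousAt.eventually_lt (by fun_prop) continuousAt_const (by norm_num)
  have h' : ∀ᶠ K : ℝ in 𝓝 1, K * σ < r :=
    ContinuousAt.eventually_lt (by fun_prop) continuousAt_const (by simpa using hσ)
  have hall : ∀ᶠ K : ℝ in 𝓝[>] 1, (K ^ d < 2 ∧ K ^ k < 2 ∧ K * σ < r) ∧ 1 < K :=
    (((h d).and ((h k).and h')).filter_mono nhdsWithin_le_nhds).and self_mem_nhdsWithin
  obtain ⟨K, ⟨h1, h2, h3⟩, h4⟩ := hall.exists
  exact ⟨K, h4, h1.le, h2.le, h3.le⟩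

/-- The product of the volume of a fiber and of the normalizing constant `splitConst`. -/
def fiberConst (d k : ℕ) (σ : ℝ) : ℝ≥0∞ :=
  splitConst d k * volume (Metric.ball (0 : Eu k) σ)

lemma fiberConst_ne_zero {σ : ℝ} (hσ : 0 < σ) : fiberConst d k σ ≠ 0 :=
  mul_ne_zero (by simpa using splitConst_ne_zero) (Metric.measure_ball_pos _ _ hσ).ne'

/-- The local comparison of the noisy law of a piece `P` of `M` with Lebesgue measure. -/
structure TubeEstimate (σ κ : ℝ) (M P : Set (Eu (d + k))) : Prop where
  aemeasurable : AEMeasurable (fun u => uniformOn (((d + k : ℕ) : ℝ) - d) (fiber σ M u))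
    ((μH[(d : ℝ)] : Measure (Eu (d + k))).restrict P)
  measurableSet : MeasurableSet (tubeOver σ M P)
  volume_le : ∀ S, MeasurableSet S → volume (S ∩ tubeOver σ M P) ≤
    ENNReal.ofReal (2 * 2 ^ d) * (4 * (fiberConst d k σ *
      ∫⁻ u in P, uniformOn (((d + k : ℕ) : ℝ) - d) (fiber σ M u) S ∂μH[(d : ℝ)]))
  le_volume : ∀ S, MeasurableSet S →
    ENNReal.ofReal (1 / 2 * (1 - (σ + κ) / 2 / κ) ^ d) * (fiberConst d k σ *
      ∫⁻ u in P, uniformOn (((d + k : ℕ) : ℝ) - d) (fiber σ M u) S ∂μH[(d : ℝ)]) ≤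
    4 * volume (S ∩ tubeOver σ M P)
  le_volume_tube :
    ENNReal.ofReal (1 / 2 * (1 / 2) ^ d * smallProportion (d * d)) *
      (fiberConst d k σ * μH[(d : ℝ)] P) ≤ 4 * volume (tubeOver σ M P)

theorem NormalChart.exists_tubeEstimate {M : Set (Eu (d + k))} {p : Eu (d + k)}
    (N : NormalChart (Eu d) (Eu k) M p) {σ κ : ℝ} (hT : IsTubular M κ) (hσ : 0 < σ)
    (hσκ : σ < κ) :
    ∃ W₀ : Set (Eu (d + k)), IsOpen W₀ ∧ p ∈ W₀ ∧ μH[(d : ℝ)] (M ∩ W₀) ≠ 0 ∧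
      μH[(d : ℝ)] (M ∩ W₀) ≠ ⊤ ∧ ∀ P ⊆ M ∩ W₀, MeasurableSet P → TubeEstimate σ κ M P := by
  have hκ : 0 < κ := hσ.trans hσκ
  -- A radius between `σ` and `κ`: fiber coordinates have norm at most `K * σ ≤ r`, and curvature is
  -- still under control at `r < κ`.
  set r := (σ + κ) / 2 with hr
  have hσr : σ < r := by rw [hr]; linarith
  have hrκ : r < κ := by rw [hr]; linarith
  obtain ⟨K, hK1, hKd, hKk, hKσ⟩ := exists_gt_one_pow_le_two d k hσr
  have hK0 : 0 < K := by linarith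
  have hj : IsOrthogonalSplitting (splitting d k) := isOrthogonalSplitting_finAddEquivProd
  obtain ⟨ε, hε, hU, hψ, hna⟩ := N.exists_nice_ball hj hT (hσ.trans hσr) hrκ hK1
  set U₀ := Metric.ball (0 : Eu d) ε with hU₀
  have hp' : p ∈ M ∩ N.W := by
    have h := N.ψ_mem 0 N.zero_mem
    rwa [N.ψ_zero] at h
  have hρp : N.ρ p = 0 := by
    have h := N.ρ_ψ 0 N.zero_mem
    rwa [N.ψ_zero] at h
  have himg : ∀ P ⊆ M ∩ (N.W ∩ N.ρ ⁻¹' U₀), N.ψ '' (U₀ ∩ N.ψ ⁻¹' P) = P := by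
    intro P hP
    ext y
    constructor
    · rintro ⟨a, ha, rfl⟩
      exact ha.2
    · intro hy
      have h := hP hy
      have hy' : N.ψ (N.ρ y) = y := N.ψ_ρ y ⟨h.1, h.2.1⟩
      exact ⟨N.ρ y, ⟨h.2.2, by rwa [mem_preimage, hy']⟩, hy'⟩
  have hcomp := fun X (hX : X ⊆ U₀) => N.hausdorffMeasure_image_comparable hK0.le hKd hU hψ hX
  have hpre : U₀ ∩ N.ψ ⁻¹' (M ∩ (N.W ∩ N.ρ ⁻¹' U₀)) = U₀ := by
    refine inter_eq_left.2 fun a ha => ?_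
    have h := N.ψ_mem a (hU ha)
    exact ⟨h.1, h.2, by rwa [mem_preimage, N.ρ_ψ a (hU ha)]⟩
  have hM0 := himg _ subset_rfl
  rw [hpre] at hM0
  refine ⟨N.W ∩ N.ρ ⁻¹' U₀, N.continuousOn_ρ.isOpen_inter_preimage N.isOpen_W Metric.isOpen_ball,
    ⟨hp'.2, by rw [mem_preimage, hρp]; exact Metric.mem_ball_self hε⟩, ?_, ?_, ?_⟩
  · intro h0
    rw [← hM0] at h0
    have h := (hcomp U₀ subset_rfl).2
    rw [h0, mul_zero] at h
    exact (Metric.measure_ball_pos _ _ hε).ne' (le_antisymm h zero_le)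
  · rw [← hM0]
    exact ne_top_of_le_ne_top (ENNReal.mul_ne_top (by simp) measure_ball_lt_top.ne)
      (hcomp U₀ subset_rfl).1
  intro P hPM hPm
  set B := U₀ ∩ N.ψ ⁻¹' P with hBdef
  have hBU₀ : B ⊆ U₀ := inter_subset_left
  have hBU : B ⊆ N.U := hBU₀.trans hU
  have hB : MeasurableSet B := measurableSet_inter_preimage_of_continuousOn
    Metric.isOpen_ball.measurableSet (N.contDiffOn_ψ.continuousOn.mono hU) hPm
  have hψB : N.ψ '' B = P := himg P hPM
  have hPm' : MeasurableSet (N.ψ '' B) := by rwa [hψB]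
  have hcr : ∀ S, ∀ q ∈ N.domain σ B S, ‖q.2‖ ≤ r := fun S q hq =>
    ((hna q.1 (hBU₀ hq.1) q.2).1.2.trans (by gcongr; exact hq.2.1.le)).trans hKσ
  have hint := fun S (hS : MeasurableSet S) => N.lintegral_uniformOn_comparable hK0 hσ hKd hKk hB
    hBU (fun a ha b hb => hψ a (hBU₀ ha) b (hBU₀ hb)) (fun a ha c => (hna a (hBU₀ ha) c).1) hPm' hS
  rw [hψB] at hint
  have hdm := fun S (hS : MeasurableSet S) => N.measurableSet_domain σ hB hBU hS
  have hsub : ∀ S, N.domain σ B S ⊆ N.domain σ B univ := fun S q hq => ⟨hq.1, hq.2.1, trivial⟩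
  have htube := fun S => N.tube_image_domain σ hBU S
  rw [hψB] at htube
  have hfr : Module.finrank ℝ (Eu d) = d := finrank_euclideanSpace_fin
  have aux : ∀ c x b I : ℝ≥0∞, x ≤ 4 * (b * I) → c * x ≤ 4 * (c * b * I) := fun c x b I h => by
    calc c * x ≤ c * (4 * (b * I)) := by gcongr
      _ = _ := by ring
  have aux' : ∀ c x b I : ℝ≥0∞, b * I ≤ 4 * x → c * b * I ≤ 4 * (c * x) := fun c x b I h => by
    calc c * b * I = c * (b * I) := mul_assoc _ _ _
      _ ≤ c * (4 * x) := by gcongr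
      _ = _ := by ring
  constructor
  · have := N.aemeasurable_uniformOn_fiber σ hB hBU hPm' μH[(d : ℝ)]
    rwa [hψB] at this
  · have h := (hdm univ MeasurableSet.univ).image_of_continuousOn_injOn (f := N.tube)
      (fun q hq => (N.hasFDerivAt_tube (hBU hq.1)).continuousAt.continuousWithinAt)
      (N.injOn_tube hσκ.le hT hBU univ)
    rwa [htube, univ_inter] at h
  · intro S hS
    rw [← htube]
    refine (N.volume_image_tube_le hσκ.le hT hBU (hdm S hS) (hsub S) (m := 2 * 2 ^ d)
      fun q hq => ?_).trans ?_
    · have := ((hna q.1 (hBU₀ hq.1) q.2).2 (hcr S q hq)).2.1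
      rwa [hfr] at this
    · rw [fiberConst]
      exact mul_le_mul_right (aux _ _ _ _ (hint S hS).2) _
  · intro S hS
    rw [← htube]
    have h := N.le_volume_image_tube hσκ.le hT hBU (hdm S hS) (hsub S)
      (m := 1 / 2 * (1 - r / κ) ^ d) fun q hq => by
        have := ((hna q.1 (hBU₀ hq.1) q.2).2 (hcr S q hq)).1
        rwa [hfr] at this
    rw [fiberConst]
    refine (mul_le_mul_right (aux' (splitConst d k) _ _ _ (hint S hS).1) _).trans ?_
    rw [mul_left_comm]
    gcongr
  -- Every fiber over `B` contains the coordinate ball of radius `s`. On its part `G` the shape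
  -- operator has norm at most `1 / 2`, so the Jacobian bound is free of `σ` and `k`. One factor two
  -- is lost from `σ` to `s`, another from `P` to `B`.
  · set s := K⁻¹ * σ with hs
    have hs0 : 0 < s := by positivity
    have hsσ : s ≤ σ := mul_le_of_le_one_left hσ.le (inv_le_one_of_one_le₀ hK1.le)
    set G := {c : Eu k | ‖c‖ < s ∧ ∑ x, N.shapeEntry x c ^ 2 ≤ 1 / 4} with hG
    have hGm : MeasurableSet G := by
      have hc : Continuous fun c => ∑ x, N.shapeEntry x c ^ 2 := continuous_finsetSum _ fun x _ =>
        (N.shapeEntry x).continuous_of_finiteDimensional.pow 2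
      exact (measurableSet_lt measurable_norm measurable_const).inter
        (measurableSet_le hc.measurable measurable_const)
    have hBG : B ×ˢ G ⊆ N.domain σ B univ := by
      rintro ⟨a, c⟩ ⟨ha, hc⟩
      refine ⟨ha, ?_, trivial⟩
      have h1 : ‖c‖ < s := hc.1
      rw [hs, lt_inv_mul_iff₀ hK0] at h1
      exact (hna a (hBU₀ ha) c).1.1.trans_lt h1
    have h := N.le_volume_image_tube hσκ.le hT hBU (hB.prod hGm) hBG
      (m := 1 / 2 * (1 / 2) ^ d) fun q hq => by
        have := ((hna q.1 (hBU₀ hq.1) q.2).2 (hcr univ q (hBG hq))).2.2 hq.2.2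
        rwa [hfr] at this
    have hGvol : ENNReal.ofReal (smallProportion (d * d)) * volume (Metric.ball (0 : Eu k) s) ≤
        volume G := by
      have hsm := smallProportion_mul_volume_ball_le (C := Eu k) N.shapeEntry hs0 fun x c =>
        (N.abs_shapeEntry_le hκ hT x c).trans (by gcongr; linarith)
      have hcard : Fintype.card (Fin (Module.finrank ℝ (Eu d)) × Fin (Module.finrank ℝ (Eu d))) =
          d * d := by simp
      rw [hcard] at hsm
      have hGt : volume G ≠ ⊤ := ((measure_mono (t := Metric.ball (0 : Eu k) s)
        fun c hc => by simpa using hc.1).trans_lt measure_ball_lt_top).ne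
      have := ENNReal.ofReal_le_ofReal hsm
      rwa [ENNReal.ofReal_mul (smallProportion_pos _).le, measureReal_def, measureReal_def,
        ENNReal.ofReal_toReal measure_ball_lt_top.ne, ENNReal.ofReal_toReal hGt] at this
    have hball : volume (Metric.ball (0 : Eu k) σ) ≤ 2 * volume (Metric.ball (0 : Eu k) s) := by
      have := volume_ball_mul_le (σ := s) hK0 hKk
      rwa [hs, mul_inv_cancel_left₀ hK0.ne'] at this
    have hHP : μH[(d : ℝ)] P ≤ 2 * μH[(d : ℝ)] B := by
      have := (hcomp B hBU₀).1
      rwa [hψB] at this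
    have htub : N.tube '' (B ×ˢ G) ⊆ tubeOver σ M P := by
      have := image_mono (f := N.tube) hBG
      rwa [htube, univ_inter] at this
    rw [Measure.prod_prod] at h
    have hm0 : (0 : ℝ) ≤ 1 / 2 * (1 / 2) ^ d := by positivity
    rw [ENNReal.ofReal_mul hm0, fiberConst]
    set m := ENNReal.ofReal (1 / 2 * (1 / 2) ^ d)
    set θ := ENNReal.ofReal (smallProportion (d * d))
    calc m * θ * (splitConst d k * volume (Metric.ball (0 : Eu k) σ) * μH[(d : ℝ)] P)
        ≤ m * θ * (splitConst d k * (2 * volume (Metric.ball (0 : Eu k) s)) *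
            (2 * μH[(d : ℝ)] B)) := by gcongr
      _ = (2 * 2) * (m * (splitConst d k * (μH[(d : ℝ)] B *
            (θ * volume (Metric.ball (0 : Eu k) s))))) := by ring
      _ ≤ (2 * 2) * (m * (splitConst d k * (μH[(d : ℝ)] B * volume G))) := by gcongr
      _ ≤ (2 * 2) * volume (tubeOver σ M P) := by
          gcongr
          exact h.trans (measure_mono htub)
      _ = _ := by norm_num

end

/-! ### From pieces to the whole manifold -/

section

variable {d k : ℕ}

lemma IsTubular.disjoint_fiber {M : Set (Eu (d + k))} {σ κ : ℝ} (hT : IsTubular M κ)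
    (hσκ : σ ≤ κ) {u v : Eu (d + k)} (hu : u ∈ M) (hv : v ∈ M) (huv : u ≠ v) :
    Disjoint (fiber σ M u) (fiber σ M v) := by
  rw [Set.disjoint_left]
  rintro y ⟨h1, h2⟩ ⟨h3, h4⟩
  rw [Metric.mem_ball, dist_eq_norm] at h2 h4
  exact huv (hT.eq_of_add_eq hu hv h1 (h2.trans_le hσκ) h3 (h4.trans_le hσκ) (by abel))

lemma IsTubular.tubeOver_self {M : Set (Eu (d + k))} (hne : M.Nonempty) {σ κ : ℝ}
    (hT : IsTubular M κ) (hσκ : σ ≤ κ) : tubeOver σ M M = Metric.thickening σ M := by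
  ext y
  simp only [tubeOver, mem_iUnion, exists_prop]
  constructor
  · rintro ⟨u, hu, -, h⟩
    exact Metric.mem_thickening_iff.2 ⟨u, hu, h⟩
  · intro h
    rw [Metric.mem_thickening_iff_infDist_lt hne] at h
    obtain ⟨u, hu, hn, hd⟩ := hT.exists_foot y (h.trans_le hσκ)
    exact ⟨u, hu, hn, by rw [Metric.mem_ball, dist_eq_norm, hd]; exact h⟩

/-- Each inequality compares countably additive functions of the piece, because the tubes over
disjoint pieces are assumed disjoint. -/
lemma TubeEstimate.iUnion {M : Set (Eu (d + k))} {σ κ : ℝ} {P : ℕ → Set (Eu (d + k))}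
    (hPm : ∀ n, MeasurableSet (P n)) (hP : Pairwise (Function.onFun Disjoint P))
    (htube : Pairwise (Function.onFun Disjoint fun n => tubeOver σ M (P n)))
    (h : ∀ n, TubeEstimate σ κ M (P n)) : TubeEstimate σ κ M (⋃ n, P n) := by
  have htU : tubeOver σ M (⋃ n, P n) = ⋃ n, tubeOver σ M (P n) := by
    simp only [tubeOver, biUnion_iUnion]
  have hvol : ∀ S, MeasurableSet S → volume (S ∩ tubeOver σ M (⋃ n, P n)) =
      ∑' n, volume (S ∩ tubeOver σ M (P n)) := by
    intro S hS
    rw [htU, inter_iUnion, measure_iUnion (fun m n hmn => (htube hmn).mono inter_subset_right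
      inter_subset_right) fun n => hS.inter (h n).measurableSet]
  constructor
  · exact aemeasurable_iUnion_iff.2 fun n => (h n).aemeasurable
  · rw [htU]
    exact MeasurableSet.iUnion fun n => (h n).measurableSet
  · intro S hS
    rw [hvol S hS, lintegral_iUnion hPm hP, ← ENNReal.tsum_mul_left, ← ENNReal.tsum_mul_left,
      ← ENNReal.tsum_mul_left]
    exact ENNReal.tsum_le_tsum fun n => (h n).volume_le S hS
  · intro S hS
    rw [hvol S hS, lintegral_iUnion hPm hP, ← ENNReal.tsum_mul_left, ← ENNReal.tsum_mul_left,
      ← ENNReal.tsum_mul_left]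
    exact ENNReal.tsum_le_tsum fun n => (h n).le_volume S hS
  · have hu := hvol univ MeasurableSet.univ
    simp only [univ_inter] at hu
    rw [hu, measure_iUnion hP hPm, ← ENNReal.tsum_mul_left, ← ENNReal.tsum_mul_left,
      ← ENNReal.tsum_mul_left]
    exact ENNReal.tsum_le_tsum fun n => (h n).le_volume_tube

/-- The comparison of the noisy law with Lebesgue measure on the whole tube, and finiteness of
the volume of `M`. -/
theorem tubeEstimate_self {M : Set (Eu (d + k))} (hne : M.Nonempty) (hM : IsCompact M)
    (hs : IsSubmanifold d M) {σ κ : ℝ} (hT : IsTubular M κ) (hσ : 0 < σ) (hσκ : σ < κ) :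
    TubeEstimate σ κ M M ∧ μH[(d : ℝ)] M ≠ 0 ∧ μH[(d : ℝ)] M ≠ ⊤ := by
  have hloc : ∀ p ∈ M, ∃ W₀ : Set (Eu (d + k)), IsOpen W₀ ∧ p ∈ W₀ ∧ μH[(d : ℝ)] (M ∩ W₀) ≠ 0 ∧
      μH[(d : ℝ)] (M ∩ W₀) ≠ ⊤ ∧ ∀ P ⊆ M ∩ W₀, MeasurableSet P → TubeEstimate σ κ M P := by
    intro p hp
    obtain ⟨Θ, hpΘ, h1, h2, h3⟩ := hs.exists_straightening hp
    obtain ⟨N⟩ := exists_normalChart h1 h2 h3 hpΘ hp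
    exact N.exists_tubeEstimate hT hσ hσκ
  choose! W hWo hpW hW0 hWt hWE using hloc
  obtain ⟨t, htM, hcover⟩ := hM.elim_nhds_subcover W fun p hp => (hWo p hp).mem_nhds (hpW p hp)
  have htne : (t : Set (Eu (d + k))).Nonempty := by
    obtain ⟨x, hx⟩ := hne
    obtain ⟨p, hp, -⟩ := mem_iUnion₂.1 (hcover hx)
    exact ⟨p, hp⟩
  refine ⟨?_, ?_, ?_⟩
  · obtain ⟨f, hf⟩ := t.countable_toSet.exists_eq_range htne
    have hft : ∀ n, f n ∈ M := fun n => htM _ (by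
      have : f n ∈ (t : Set (Eu (d + k))) := hf ▸ mem_range_self n
      exact this)
    -- A finite chart cover, enumerated with repetitions and made disjoint; each piece stays inside
    -- one chart domain, and distinct base points have disjoint fibers.
    let P : ℕ → Set (Eu (d + k)) := fun n => M ∩ disjointed (fun n => W (f n)) n
    have hPM : ∀ n, P n ⊆ M ∩ W (f n) := fun n =>
      inter_subset_inter_right _ (disjointed_subset _ n)
    have hPm : ∀ n, MeasurableSet (P n) := fun n => hM.measurableSet.inter
      (MeasurableSet.disjointed (fun n => (hWo _ (hft n)).measurableSet) n)
    have hPd : Pairwise (Function.onFun Disjoint P) := fun m n hmn =>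
      ((disjoint_disjointed _) hmn).mono inter_subset_right inter_subset_right
    have hPU : ⋃ n, P n = M := by
      rw [← inter_iUnion, iUnion_disjointed, inter_eq_left]
      intro x hx
      obtain ⟨p, hp, hxp⟩ := mem_iUnion₂.1 (hcover hx)
      have hp' : p ∈ range f := hf ▸ hp
      obtain ⟨n, rfl⟩ := hp'
      exact mem_iUnion.2 ⟨n, hxp⟩
    have htube : Pairwise (Function.onFun Disjoint fun n => tubeOver σ M (P n)) := by
      intro m n hmn
      simp only [Function.onFun, tubeOver]
      rw [disjoint_iUnion₂_left]
      intro u hu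
      rw [disjoint_iUnion₂_right]
      intro v hv
      refine hT.disjoint_fiber hσκ.le (hPM m hu).1 (hPM n hv).1 ?_
      rintro rfl
      exact Set.disjoint_left.1 (hPd hmn) hu hv
    have := TubeEstimate.iUnion hPm hPd htube fun n => hWE _ (hft n) (P n) (hPM n) (hPm n)
    rwa [hPU] at this
  · obtain ⟨p, hp⟩ := hne
    exact fun h0 => hW0 p hp (measure_mono_null inter_subset_left h0)
  · have : M ⊆ ⋃ p ∈ t, M ∩ W p := fun x hx => by
      obtain ⟨p, hp, hxp⟩ := mem_iUnion₂.1 (hcover hx)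
      exact mem_iUnion₂.2 ⟨p, hp, hx, hxp⟩
    exact ((measure_mono this).trans_lt (measure_biUnion_lt_top t.finite_toSet
      fun p hp => (hWt p (htM p hp)).lt_top)).ne

end

/-! ### The density of the noisy law -/

section

variable {d k : ℕ}

lemma uniformOn_apply_le_one {D : ℕ} (s σ : ℝ) (M : Set (Eu D)) (u : Eu D) (S : Set (Eu D)) :
    uniformOn s (fiber σ M u) S ≤ 1 := by
  rw [uniformOn, ProbabilityTheory.cond_apply (NormalChart.measurableSet_fiber σ M u)]
  exact (mul_le_mul_right (measure_mono inter_subset_left) _).trans (ENNReal.inv_mul_le_one _)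

section Law

variable {M : Set (Eu (d + k))} {σ κ : ℝ}

/-- The almost everywhere measurability recorded in `TubeEstimate` justifies evaluating the `bind`
as an integral. -/
lemma noisyLaw_apply (hE : TubeEstimate σ κ M M) {S : Set (Eu (d + k))}
    (hS : MeasurableSet S) :
    noisyLaw d σ M S = (μH[(d : ℝ)] M)⁻¹ *
      ∫⁻ u in M, uniformOn (((d + k : ℕ) : ℝ) - d) (fiber σ M u) S ∂μH[(d : ℝ)] := by
  have hae : AEMeasurable (fun u => uniformOn (((d + k : ℕ) : ℝ) - d) (fiber σ M u))
      (uniformOn (d : ℝ) M) := hE.aemeasurable.mono_ac (by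
    rw [uniformOn, ProbabilityTheory.cond]
    exact Measure.smul_absolutelyContinuous)
  rw [noisyLaw, Measure.bind_apply hS hae, uniformOn, ProbabilityTheory.cond,
    lintegral_smul_measure, smul_eq_mul]

lemma noisyLaw_mul (hE : TubeEstimate σ κ M M) (h0 : μH[(d : ℝ)] M ≠ 0)
    (ht : μH[(d : ℝ)] M ≠ ⊤) {S : Set (Eu (d + k))} (hS : MeasurableSet S) :
    fiberConst d k σ * ∫⁻ u in M, uniformOn (((d + k : ℕ) : ℝ) - d) (fiber σ M u) S ∂μH[(d : ℝ)] =
      noisyLaw d σ M S * (fiberConst d k σ * μH[(d : ℝ)] M) := by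
  rw [noisyLaw_apply hE hS, mul_comm (fiberConst d k σ) (μH[(d : ℝ)] M), ← mul_assoc,
    mul_right_comm _ _ (μH[(d : ℝ)] M), ENNReal.inv_mul_cancel h0 ht, one_mul, mul_comm]

lemma noisyLaw_univ_le_one (hE : TubeEstimate σ κ M M) :
    noisyLaw d σ M univ ≤ 1 := by
  rw [noisyLaw_apply hE MeasurableSet.univ]
  refine le_trans (mul_le_mul_right (lintegral_mono fun u => uniformOn_apply_le_one _ _ _ _ _) _) ?_
  rw [setLIntegral_const, one_mul]
  exact ENNReal.inv_mul_le_one _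

lemma noisyLaw_absolutelyContinuous (hσ : 0 < σ) (hσκ : σ < κ)
    (hE : TubeEstimate σ κ M M) (h0 : μH[(d : ℝ)] M ≠ 0) (ht : μH[(d : ℝ)] M ≠ ⊤) :
    noisyLaw d σ M ≪ volume := by
  refine Measure.AbsolutelyContinuous.mk fun S hS hvol => ?_
  have h := hE.le_volume S hS
  rw [measure_mono_null inter_subset_left hvol, mul_zero, noisyLaw_mul hE h0 ht hS] at h
  have hκ : 0 < κ := hσ.trans hσκ
  have hpos : 0 < 1 - (σ + κ) / 2 / κ := by
    rw [sub_pos, div_lt_one hκ]; linarith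
  have h' := nonpos_iff_eq_zero.1 h
  rw [mul_eq_zero, mul_eq_zero, mul_eq_zero] at h'
  rcases h' with h1 | h1 | h1 | h1
  · exact absurd h1 (by rw [ENNReal.ofReal_eq_zero, not_le]; positivity)
  · exact h1
  · exact absurd h1 (fiberConst_ne_zero hσ)
  · exact absurd h1 h0

/-- The two-sided comparison of the noisy law with the uniform distribution on the tube. -/
lemma noisyLaw_comparable (hne : M.Nonempty) (hT : IsTubular M κ)
    (hσκ : σ < κ) (hE : TubeEstimate σ κ M M) (h0 : μH[(d : ℝ)] M ≠ 0)
    (ht : μH[(d : ℝ)] M ≠ ⊤) {S : Set (Eu (d + k))} (hS : MeasurableSet S) :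
    ENNReal.ofReal (1 / 2 * (1 / 2) ^ d * smallProportion (d * d)) *
        volume (S ∩ Metric.thickening σ M) ≤
      ENNReal.ofReal (16 * (2 * 2 ^ d)) *
        (noisyLaw d σ M S * volume (Metric.thickening σ M)) ∧
    ENNReal.ofReal (1 / 2 * (1 - (σ + κ) / 2 / κ) ^ d) *
        (noisyLaw d σ M S * volume (Metric.thickening σ M)) ≤
      ENNReal.ofReal (16 * (2 * 2 ^ d)) * volume (S ∩ Metric.thickening σ M) := by
  have e1 := hE.volume_le S hS
  have e2 := hE.le_volume S hS
  have e3 := hE.le_volume_tube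
  have e4 := hE.volume_le univ MeasurableSet.univ
  rw [noisyLaw_mul hE h0 ht hS] at e1 e2
  rw [noisyLaw_mul hE h0 ht MeasurableSet.univ, univ_inter] at e4
  rw [hT.tubeOver_self hne hσκ.le] at e1 e2 e3 e4
  have h16 : ENNReal.ofReal (16 * (2 * 2 ^ d)) = 16 * ENNReal.ofReal (2 * 2 ^ d) := by
    rw [ENNReal.ofReal_mul (by norm_num)]; norm_num
  rw [h16]
  set c := ENNReal.ofReal (2 * 2 ^ d)
  set m := ENNReal.ofReal (1 / 2 * (1 - (σ + κ) / 2 / κ) ^ d)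
  set θ := ENNReal.ofReal (1 / 2 * (1 / 2) ^ d * smallProportion (d * d))
  set w := fiberConst d k σ * μH[(d : ℝ)] M
  set V := volume (Metric.thickening σ M)
  set Q := noisyLaw d σ M S
  have e16 : (16 : ℝ≥0∞) = 4 * 4 := by norm_num
  constructor
  -- The uncomputed constant `w` is eliminated by `e3`, the averaged bound `θ * w ≤ 4 * V`.
  · calc θ * volume (S ∩ Metric.thickening σ M) ≤ θ * (c * (4 * (Q * w))) := by gcongr
      _ = 4 * c * Q * (θ * w) := by ring
      _ ≤ 4 * c * Q * (4 * V) := by gcongr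
      _ = _ := by rw [e16]; ring
  -- Here `w` is eliminated the other way: `e4` and total mass at most one give `V ≤ 4 * c * w`.
  · calc m * (Q * V) ≤ m * (Q * (c * (4 * (1 * w)))) := by
          gcongr
          refine e4.trans ?_
          gcongr
          exact noisyLaw_univ_le_one hE
      _ = 4 * c * (m * (Q * w)) := by ring
      _ ≤ 4 * c * (4 * volume (S ∩ Metric.thickening σ M)) := by gcongr
      _ = _ := by rw [e16]; ring

/-- The lower constant in the comparison of the noisy density with the uniform density. -/
def lowerConst (d : ℕ) : ℝ :=
  1 / 2 * (1 / 2) ^ d * smallProportion (d * d) / (16 * (2 * 2 ^ d))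

/-- The upper constant in the comparison of the noisy density with the uniform density. -/
def upperConst (d : ℕ) (σ κ : ℝ) : ℝ :=
  16 * (2 * 2 ^ d) / (1 / 2 * (1 - (σ + κ) / 2 / κ) ^ d)

lemma lowerConst_pos (d : ℕ) : 0 < lowerConst d := by
  have := smallProportion_pos (d * d)
  unfold lowerConst; positivity

/-- On the tube the ratio is the density times the volume of the tube. Absolute continuity
identifies its integrals with values of the law, so `noisyLaw_comparable` on all measurable subsets
gives the pointwise bounds. -/
lemma ae_noisyDensity_div_uniformDensity (hne : M.Nonempty)
    (hT : IsTubular M κ) (hσ : 0 < σ) (hσκ : σ < κ) (hE : TubeEstimate σ κ M M)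
    (h0 : μH[(d : ℝ)] M ≠ 0) (ht : μH[(d : ℝ)] M ≠ ⊤) :
    ∀ᵐ y ∂volume.restrict (Metric.thickening σ M),
      ENNReal.ofReal (lowerConst d) ≤ noisyDensity d σ M y / uniformDensity σ M y ∧
        noisyDensity d σ M y / uniformDensity σ M y ≤ ENNReal.ofReal (upperConst d σ κ) := by
  have hκ : 0 < κ := hσ.trans hσκ
  have hpos : 0 < 1 - (σ + κ) / 2 / κ := by
    rw [sub_pos, div_lt_one hκ]; linarith
  set T := Metric.thickening σ M
  have hTm : MeasurableSet T := Metric.isOpen_thickening.measurableSet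
  have hac := noisyLaw_absolutelyContinuous hσ hσκ hE h0 ht
  have hfin : IsFiniteMeasure (noisyLaw d σ M) :=
    ⟨(noisyLaw_univ_le_one hE).trans_lt ENNReal.one_lt_top⟩
  have hratio : ∀ y ∈ T, noisyDensity d σ M y / uniformDensity σ M y =
      volume T * noisyDensity d σ M y := by
    intro y hy
    rw [uniformDensity, indicator_of_mem hy, one_div, div_eq_mul_inv, inv_inv, mul_comm]
  have hq : Measurable (noisyDensity d σ M) := Measure.measurable_rnDeriv _ _
  have hint : ∀ S, MeasurableSet S → ∫⁻ y in S, volume T * noisyDensity d σ M y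
      ∂volume.restrict T = noisyLaw d σ M (S ∩ T) * volume T := by
    intro S hS
    rw [lintegral_const_mul _ hq, Measure.restrict_restrict hS, noisyDensity,
      Measure.setLIntegral_rnDeriv hac, mul_comm]
  have hint' : ∀ S, MeasurableSet S → ∀ c : ℝ≥0∞, ∫⁻ _ in S, c ∂volume.restrict T =
      c * volume (S ∩ T) := by
    intro S hS c
    rw [setLIntegral_const, Measure.restrict_apply hS]
  have hcomp : ∀ S, MeasurableSet S → _ := fun S hS =>
    noisyLaw_comparable hne hT hσκ hE h0 ht (hS.inter hTm)
  have hlow : ∀ᵐ y ∂volume.restrict T,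
      ENNReal.ofReal (lowerConst d) ≤ volume T * noisyDensity d σ M y := by
    refine ae_le_of_forall_setLIntegral_le_of_sigmaFinite measurable_const fun S hS _ => ?_
    rw [hint S hS, hint' S hS, lowerConst, ENNReal.ofReal_div_of_pos (by positivity),
      ENNReal.mul_comm_div, ← mul_div_assoc]
    have h := (hcomp S hS).1
    rw [inter_assoc, inter_self] at h
    exact ENNReal.div_le_of_le_mul' h
  have hupp : ∀ᵐ y ∂volume.restrict T,
      volume T * noisyDensity d σ M y ≤ ENNReal.ofReal (upperConst d σ κ) := by
    refine ae_le_of_forall_setLIntegral_le_of_sigmaFinite (hq.const_mul _) fun S hS _ => ?_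
    have hm0 : 0 < 1 / 2 * (1 - (σ + κ) / 2 / κ) ^ d := by positivity
    rw [hint S hS, hint' S hS, upperConst, ENNReal.ofReal_div_of_pos hm0]
    have h := (hcomp S hS).2
    rw [inter_assoc, inter_self] at h
    rw [ENNReal.mul_comm_div, ← mul_div_assoc,
      ENNReal.le_div_iff_mul_le (Or.inl (by simpa using hm0)) (Or.inl ENNReal.ofReal_ne_top),
      mul_comm]
    exact h
  filter_upwards [hlow, hupp, ae_restrict_mem hTm] with y h1 h2 hy
  rw [hratio y hy]
  exact ⟨h1, h2⟩

end Law

end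

end TubeModel

end

theorem mainTheorem8 (d : ℕ) (κ : ℝ) (hκ : 0 < κ) :
    ∃ Clow : ℝ, 0 < Clow ∧ ∀ σ : ℝ, 0 < σ → σ < κ → ∃ Cup : ℝ, Clow ≤ Cup ∧
      ∀ D : ℕ, d < D → ∀ K : Set (EuclideanSpace ℝ (Fin D)), IsCompact K →
        (TubeModel.manifoldClass d κ K).Nonempty →
        (∀ M ∈ TubeModel.manifoldClass d κ K, TubeModel.noisyLaw d σ M ≪ volume) ∧
        ENNReal.ofReal Clow ≤
          (⨅ M ∈ TubeModel.manifoldClass d κ K,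
            essInf (fun y => TubeModel.noisyDensity d σ M y / TubeModel.uniformDensity σ M y)
              (volume.restrict (Metric.thickening σ M))) ∧
        (⨅ M ∈ TubeModel.manifoldClass d κ K,
            essInf (fun y => TubeModel.noisyDensity d σ M y / TubeModel.uniformDensity σ M y)
              (volume.restrict (Metric.thickening σ M))) ≤
          (⨆ M ∈ TubeModel.manifoldClass d κ K,
            essSup (fun y => TubeModel.noisyDensity d σ M y / TubeModel.uniformDensity σ M y)
              (volume.restrict (Metric.thickening σ M))) ∧
        (⨆ M ∈ TubeModel.manifoldClass d κ K,
            essSup (fun y => TubeModel.noisyDensity d σ M y / TubeModel.uniformDensity σ M y)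
              (volume.restrict (Metric.thickening σ M))) ≤
          ENNReal.ofReal Cup := by
  refine ⟨TubeModel.lowerConst d, TubeModel.lowerConst_pos d, fun σ hσ hσκ =>
    -- The maximum makes the required ordering of the two constants immediate.
    ⟨max (TubeModel.lowerConst d) (TubeModel.upperConst d σ κ), le_max_left _ _,
      fun D hD K _ hne => ?_⟩⟩
  obtain ⟨k, rfl⟩ := Nat.exists_eq_add_of_le hD.le
  have key : ∀ M ∈ TubeModel.manifoldClass d κ K, TubeModel.noisyLaw d σ M ≪ volume ∧
      ENNReal.ofReal (TubeModel.lowerConst d) ≤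
        essInf (fun y => TubeModel.noisyDensity d σ M y / TubeModel.uniformDensity σ M y)
          (volume.restrict (Metric.thickening σ M)) ∧
      essInf (fun y => TubeModel.noisyDensity d σ M y / TubeModel.uniformDensity σ M y)
          (volume.restrict (Metric.thickening σ M)) ≤
        essSup (fun y => TubeModel.noisyDensity d σ M y / TubeModel.uniformDensity σ M y)
          (volume.restrict (Metric.thickening σ M)) ∧
      essSup (fun y => TubeModel.noisyDensity d σ M y / TubeModel.uniformDensity σ M y)
          (volume.restrict (Metric.thickening σ M)) ≤
        ENNReal.ofReal (TubeModel.upperConst d σ κ) := by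
    rintro M ⟨hMne, hM, hs, -, hr⟩
    have hT := TubeModel.isTubular_of_le_reach hMne hM hs hr
    obtain ⟨hE, h0, ht⟩ := TubeModel.tubeEstimate_self hMne hM hs hT hσ hσκ
    have hae := TubeModel.ae_noisyDensity_div_uniformDensity hMne hT hσ hσκ hE h0 ht
    -- The tube is open and nonempty; without positive measure the essential infimum could exceed
    -- the essential supremum.
    have hV0 : volume.restrict (Metric.thickening σ M) ≠ 0 := by
      rw [Ne, Measure.restrict_eq_zero]
      exact (Metric.isOpen_thickening.measure_pos volume
        (hMne.mono (Metric.self_subset_thickening hσ M))).ne'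
    have : (ae (volume.restrict (Metric.thickening σ M))).NeBot := ae_neBot.2 hV0
    exact ⟨TubeModel.noisyLaw_absolutelyContinuous hσ hσκ hE h0 ht,
      le_essInf_of_ae_le _ (hae.mono fun y hy => hy.1), Filter.liminf_le_limsup,
      essSup_le_of_ae_le _ (hae.mono fun y hy => hy.2)⟩
  refine ⟨fun M hM => (key M hM).1, le_iInf₂ fun M hM => (key M hM).2.1, ?_,
    iSup₂_le fun M hM => (key M hM).2.2.2.trans (ENNReal.ofReal_le_ofReal (le_max_right _ _))⟩
  obtain ⟨M, hM⟩ := hne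
  exact (iInf₂_le M hM).trans ((key M hM).2.2.1.trans
    (le_iSup₂_of_le M hM le_rfl))
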